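/- Let $d\ge 1$, let $m_1,\dots,m_{d+1}>0$ be masses with total mass $M=\sum_a m_a$, and let $G>0$. For a configuration $q=(q_1,\dots,q_{d+1})\in(\mathbb R^d)^{d+1}$ put $r_{ab}=|q_a-q_b|$, and use the mass inner product $\langle x,y\rangle=\sum_a m_a\,x_a\cdot y_a$ on $(\mathbb R^d)^{d+1}$. Let $\Sigma$ be the degeneration locus, the set of configurations all of whose $d+1$ points lie on one affine hyperplane of $\mathbb R^d$, and let $S(q)=\operatorname{sign}\bigl(\det(q_2-q_1,\dots,q_{d+1}-q_1)\bigr)\operatorname{dist}(q,\Sigma)$ be the signed distance, where $\operatorname{dist}$ is the distance of the mass inner product and $\operatorname{sign}(0)=0$. Consider Newton's equations $\ddot q=-\nabla V(q)$ (gradient with respect to the mass inner product, on collision-free configurations) with potential $V(q)=G\sum_{a<b}m_am_b f_{ab}(r_{ab})$, where each $f_{ab}:(0,\infty)\to\mathbb R$ is twice differentiable and satisfies $f_{ab}'>0$, $f_{ab}''<0$ and $\lim_{r\to\infty}f_{ab}'(r)/r=0$; the Newtonian case is $f_{ab}(r)=-1/r$. For $c>0$ let $\delta(c)=\min_{a<b}f_{ab}'(c)/c$.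 The angular momentum is taken in the centre-of-mass frame: $J(q,v)=\sum_a m_a (q_a-q_{cm})\wedge (v_a-v_{cm})$, where $q_{cm}=\frac1M\sum_a m_aq_a$ and $v_{cm}=\frac1M\sum_a m_av_a$. Let $\mathcal R$ be the set of states $(q,v)$ such that $q$ is collision-free, $S$ is smooth ($C^\infty$) at $q$, and $J(q,v)=0$. Then there is a continuous function $g:\mathcal R\to(0,\infty)$, depending only on $d$, the masses, $G$ and the $f_{ab}$, such that along every solution $q(t)$ of Newton's equations, defined on any time interval, that has zero angular momentum and along which $S$ is smooth at every point $q(t)$, the function $S(t)=S(q(t))$ is twice differentiable and $$\ddot S=-S\,g(q,\dot q).$$ Moreover, at every $(q,v)\in\mathcal R$ with $r_{ab}\le c$ for all pairs $a,b$ one has $g(q,v)\ge GM\,\delta(c)$, and in the Newtonian case $g(q,v)\ge GM/c^3$. -/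

import Mathlib

open scoped ContDiff Topology

noncomputable section

namespace NBody

/-- Configurations of `d + 1` point masses in Euclidean `d`-space; also used for their velocities. -/
abbrev Config (d : ℕ) : Type := Fin (d + 1) → EuclideanSpace ℝ (Fin d)

/-- The mass (kinetic energy) inner product `⟨x, y⟩ = ∑ mₐ xₐ · yₐ`. -/
def massInner {d : ℕ} (m : Fin (d + 1) → ℝ) (x y : Config d) : ℝ :=
  ∑ a, m a * inner ℝ (x a) (y a)

/-- The norm of the mass inner product. -/
def massNorm {d : ℕ} (m : Fin (d + 1) → ℝ) (x : Config d) : ℝ :=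
  Real.sqrt (massInner m x x)

/-- The degeneration locus: all `d + 1` masses lie on a single affine hyperplane. -/
def degenerationLocus (d : ℕ) : Set (Config d) :=
  {q | ∃ n : EuclideanSpace ℝ (Fin d), n ≠ 0 ∧ ∃ h : ℝ, ∀ a, inner ℝ n (q a) = h}

/-- `d!` times the signed volume of the simplex with vertices `q₀, …, q_d`, that is, the
determinant of the matrix with columns `q₁ - q₀, …, q_d - q₀`. -/
def volumeDet {d : ℕ} (q : Config d) : ℝ :=
  (Matrix.of fun i j : Fin d => q j.succ i - q 0 i).det

/-- The signed distance to the degeneration locus, relative to the mass inner product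
(`Real.sign 0 = 0`). -/
def signedDistance {d : ℕ} (m : Fin (d + 1) → ℝ) (q : Config d) : ℝ :=
  Real.sign (volumeDet q) * ⨅ p : degenerationLocus d, massNorm m (q - (p : Config d))

/-- The total mass `M`. -/
def totalMass {d : ℕ} (m : Fin (d + 1) → ℝ) : ℝ := ∑ a, m a

/-- The centre of mass of `x`; for velocities, the velocity of the centre of mass. -/
def centerOfMass {d : ℕ} (m : Fin (d + 1) → ℝ) (x : Config d) : EuclideanSpace ℝ (Fin d) :=
  (totalMass m)⁻¹ • ∑ a, m a • x a

/-- The total angular momentum `∑ mₐ xₐ ∧ wₐ` in the centre-of-mass frame, where `x` and `w` are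
the positions and velocities relative to the centre of mass; the bivector `x ∧ w` is written as the
skew-symmetric matrix with entries `xᵢ wⱼ - xⱼ wᵢ`. -/
def angularMomentum {d : ℕ} (m : Fin (d + 1) → ℝ) (q v : Config d) :
    Matrix (Fin d) (Fin d) ℝ :=
  let x : Config d := fun a => q a - centerOfMass m q
  let w : Config d := fun a => v a - centerOfMass m v
  Matrix.of fun i j => ∑ a, m a * (x a i * w a j - x a j * w a i)

/-- The potential `V(q) = G ∑ mₐ m_b f_{ab}(r_{ab})`, summed once over each pair `a < b`. -/
def potential {d : ℕ} (G : ℝ) (m : Fin (d + 1) → ℝ)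
    (f : Fin (d + 1) → Fin (d + 1) → ℝ → ℝ) (q : Config d) : ℝ :=
  G * ∑ a, ∑ b ∈ Finset.Ioi a, m a * m b * f a b (dist (q a) (q b))

/-- The hypothesis on a two-body potential: `f' > 0` and `f'' < 0` on `(0, ∞)` (nonzero values of
`deriv` entail that the derivatives exist), and `f'(r) / r → 0` as `r → ∞`. -/
structure IsAttractive (f : ℝ → ℝ) : Prop where
  deriv_pos : ∀ r : ℝ, 0 < r → 0 < deriv f r
  deriv_deriv_neg : ∀ r : ℝ, 0 < r → deriv (deriv f) r < 0
  tendsto : Filter.Tendsto (fun r : ℝ => deriv f r / r) Filter.atTop (𝓝 0)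

/-- The Newtonian two-body potentials `f_{ab}(r) = -1 / r`. -/
def newtonian (d : ℕ) : Fin (d + 1) → Fin (d + 1) → ℝ → ℝ := fun _ _ r => -1 / r

/-- `δ(c)`, the minimum over all pairs `a < b` of `f_{ab}'(c) / c`. -/
def delta {d : ℕ} (f : Fin (d + 1) → Fin (d + 1) → ℝ → ℝ) (c : ℝ) : ℝ :=
  ⨅ p : {p : Fin (d + 1) × Fin (d + 1) // p.1 < p.2}, deriv (f p.1.1 p.1.2) c / c

/-- `w` is the gradient at `q` of the function `F` with respect to the mass inner product. -/
def IsMassGradientAt {d : ℕ} (m : Fin (d + 1) → ℝ) (F : Config d → ℝ) (q w : Config d) : Prop :=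
  DifferentiableAt ℝ F q ∧ ∀ x : Config d, fderiv ℝ F q x = massInner m w x

/-- No two of the masses are at the same place. -/
def CollisionFree {d : ℕ} (q : Config d) : Prop := ∀ a b, a ≠ b → q a ≠ q b

/-- `q`, with velocity `v`, solves Newton's equations `q'' = -∇V(q)` on the time interval `I`
(derivatives are one-sided at endpoints of `I` that belong to `I`). -/
structure IsSolutionOn {d : ℕ} (G : ℝ) (m : Fin (d + 1) → ℝ)
    (f : Fin (d + 1) → Fin (d + 1) → ℝ → ℝ) (I : Set ℝ) (q v : ℝ → Config d) : Prop where
  collisionFree : ∀ t ∈ I, CollisionFree (q t)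
  velocity : ∀ t ∈ I, HasDerivWithinAt q (v t) I t
  newton : ∀ t ∈ I, ∃ w : Config d,
    IsMassGradientAt m (potential G m f) (q t) w ∧ HasDerivWithinAt v (-w) I t

/-- `S` is smooth at the configuration `q`. -/
def SmoothAt {d : ℕ} (m : Fin (d + 1) → ℝ) (q : Config d) : Prop :=
  ContDiffAt ℝ ∞ (signedDistance m) q

/-- The states `(q, v)` through which the solutions under consideration pass: no collision, `S`
smooth at `q`, zero angular momentum. -/
def regularStates {d : ℕ} (m : Fin (d + 1) → ℝ) : Set (Config d × Config d) :=
  {s | CollisionFree s.1 ∧ SmoothAt m s.1 ∧ angularMomentum m s.1 s.2 = 0}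

/-- `g` is a positive continuous function of the state such that `S'' = -S g(q, q')` along every
zero angular momentum solution along which `S` is smooth. -/
structure IsOscillatorCoefficient {d : ℕ} (G : ℝ) (m : Fin (d + 1) → ℝ)
    (f : Fin (d + 1) → Fin (d + 1) → ℝ → ℝ) (g : Config d × Config d → ℝ) : Prop where
  pos : ∀ s ∈ regularStates m, 0 < g s
  continuousOn : ContinuousOn g (regularStates m)
  equation : ∀ (I : Set ℝ), I.OrdConnected → ∀ q v : ℝ → Config d, IsSolutionOn G m f I q v →
    (∀ t ∈ I, angularMomentum m (q t) (v t) = 0) → (∀ t ∈ I, SmoothAt m (q t)) →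
    ∃ S' : ℝ → ℝ, ∀ t ∈ I,
      HasDerivWithinAt (fun τ => signedDistance m (q τ)) (S' t) I t ∧
      HasDerivWithinAt S' (-signedDistance m (q t) * g (q t, v t)) I t

end NBody

end

/-! Let x be the centred configuration and A = ∑ mₐ xₐ ⊗ xₐ. A unit normal n gives hyperplane
configurations at least squared distance n·An from q, with equality for projection onto the
hyperplane through the centre of mass. So S² is the least eigenvalue of A
(`exists_unit_signedDistance_sq`), and S is a signed smallest singular value of x. Where S is
differentiable and nonzero, an envelope argument gives the mass gradient u ⊗ n of S, with n and u
the corresponding singular vectors. Where S is C¹ and zero, the pair (n, u) is a limit of pairs at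
nondegenerate configurations (`exists_isSingularPair`).

Along a solution S'' = D²S(v, v) - dS(∇V), and each term is S times a controlled factor. Force:
dS(∇V) is the derivative of V along u ⊗ n, where r_ab changes at rate S (uₐ - u_b)² / r_ab. This
gives S times a positive pair sum, bounded below through ∑ mₐ m_b (uₐ - u_b)² = M. Hessian:
smoothness forces the least eigenvalue to be simple, so K_s = A + n ⊗ n - s is invertible for s ≤
S². Zero angular momentum makes ∑ mₐ xₐ ⊗ vₐ symmetric in centred velocities. Since d + 1 points in
dimension d leave no further directions, differentiating the singular vector equations gives D²S(v,
v) = -S (4 b·K_{S²}⁻¹b - b·K₀⁻¹b), b being the transverse velocity (`hessian_eq`). The bracket is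
nonnegative because K_{S²} ≤ K₀. The coefficient g is the sum of the two factors. It does not depend
on the sign of (n, u), and is continuous because the pair has local differentiable choices. -/

noncomputable section

namespace NBody

/-! ### Distance to the degeneration locus as a smallest eigenvalue -/

section

variable {d : ℕ} {m : Fin (d + 1) → ℝ}

/-- The position of the mass `a` relative to the centre of mass. -/
def centered (m : Fin (d + 1) → ℝ) (q : Config d) (a : Fin (d + 1)) : EuclideanSpace ℝ (Fin d) :=
  q a - centerOfMass m q

theorem totalMass_pos (hm : ∀ a, 0 < m a) : 0 < totalMass m :=
  Finset.sum_pos (fun a _ => hm a) Finset.univ_nonempty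

theorem totalMass_smul_centerOfMass (hm : ∀ a, 0 < m a) (q : Config d) :
    totalMass m • centerOfMass m q = ∑ a, m a • q a := by
  rw [centerOfMass, smul_smul, mul_inv_cancel₀ (totalMass_pos hm).ne', one_smul]

theorem sum_smul_centered (hm : ∀ a, 0 < m a) (q : Config d) :
    ∑ a, m a • centered m q a = 0 := by
  simp only [centered, smul_sub, Finset.sum_sub_distrib, ← Finset.sum_smul]
  rw [← totalMass_smul_centerOfMass hm, totalMass, sub_self]

theorem sum_smul_centered_of_sum_eq_zero (q : Config d) {c : Fin (d + 1) → ℝ}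
    (hc : ∑ a, c a = 0) : ∑ a, c a • centered m q a = ∑ a, c a • q a := by
  simp only [centered, smul_sub, Finset.sum_sub_distrib, ← Finset.sum_smul, hc]
  simp

theorem sum_mul_inner_centered (hm : ∀ a, 0 < m a) (q : Config d)
    (w : EuclideanSpace ℝ (Fin d)) : ∑ a, m a * inner ℝ w (centered m q a) = 0 := by
  have h := congrArg (fun z => inner ℝ w z) (sum_smul_centered hm q)
  simpa [inner_sum, inner_smul_right] using h

theorem centerOfMass_add_smul (q p : Config d) (t : ℝ) :
    centerOfMass m (q + t • p) = centerOfMass m q + t • centerOfMass m p := by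
  simp only [centerOfMass, Pi.add_apply, Pi.smul_apply, smul_add, Finset.sum_add_distrib]
  simp only [smul_comm _ t, ← Finset.smul_sum]

theorem centered_add_smul (q p : Config d) (t : ℝ) (a : Fin (d + 1)) :
    centered m (q + t • p) a = centered m q a + t • centered m p a := by
  simp only [centered, centerOfMass_add_smul, Pi.add_apply, Pi.smul_apply, smul_sub]
  abel

theorem centered_sub_centered (q : Config d) (a b : Fin (d + 1)) :
    centered m q a - centered m q b = q a - q b := by
  simp [centered]

theorem continuous_centered (m : Fin (d + 1) → ℝ) (a : Fin (d + 1)) :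
    Continuous fun q : Config d => centered m q a := by
  unfold centered centerOfMass
  fun_prop

/-- The quadratic form `w ↦ ∑ mₐ (w · xₐ)²` of the positions relative to the centre of mass. -/
def gramForm (m : Fin (d + 1) → ℝ) (q : Config d) (w : EuclideanSpace ℝ (Fin d)) : ℝ :=
  ∑ a, m a * inner ℝ w (centered m q a) ^ 2

theorem gramForm_nonneg (hm : ∀ a, 0 < m a) (q : Config d) (w : EuclideanSpace ℝ (Fin d)) :
    0 ≤ gramForm m q w :=
  Finset.sum_nonneg fun a _ => mul_nonneg (hm a).le (sq_nonneg _)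

theorem gramForm_smul (q : Config d) (c : ℝ) (w : EuclideanSpace ℝ (Fin d)) :
    gramForm m q (c • w) = c ^ 2 * gramForm m q w := by
  simp only [gramForm, inner_smul_left, Finset.mul_sum]
  refine Finset.sum_congr rfl fun a _ => ?_
  simp
  ring

theorem continuous_gramForm (m : Fin (d + 1) → ℝ) (q : Config d) :
    Continuous (gramForm m q) := by
  unfold gramForm
  fun_prop

theorem volumeDet_eq_zero_of_inner {q : Config d} {n : EuclideanSpace ℝ (Fin d)} (hn : n ≠ 0)
    (h : ∀ a b, inner ℝ n (q a - q b) = 0) : volumeDet q = 0 := by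
  refine Matrix.exists_vecMul_eq_zero_iff.mp ⟨n.ofLp, ?_, ?_⟩
  · intro h0
    exact hn (by ext i; simpa using congrFun h0 i)
  · ext j
    have := h j.succ 0
    rw [PiLp.inner_apply] at this
    simpa [Matrix.vecMul, dotProduct, mul_comm] using this

theorem exists_inner_of_volumeDet_eq_zero {q : Config d} (h : volumeDet q = 0) :
    ∃ n : EuclideanSpace ℝ (Fin d), n ≠ 0 ∧ ∀ a, inner ℝ n (q a - q 0) = 0 := by
  obtain ⟨w, hw, hw'⟩ := Matrix.exists_vecMul_eq_zero_iff.mpr h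
  refine ⟨WithLp.toLp 2 w, ?_, ?_⟩
  · intro h0
    exact hw (by ext i; simpa using congrArg (fun z => z.ofLp i) h0)
  · intro a
    refine Fin.cases ?_ (fun j => ?_) a
    · simp
    · have := congrFun hw' j
      rw [PiLp.inner_apply]
      simpa [Matrix.vecMul, dotProduct, mul_comm] using this

theorem volumeDet_eq_zero_of_sum {q : Config d} {c : Fin (d + 1) → ℝ} (hc : c ≠ 0)
    (hsum : ∑ a, c a = 0) (h : ∑ a, c a • q a = 0) : volumeDet q = 0 := by
  refine Matrix.exists_mulVec_eq_zero_iff.mp ⟨fun j => c j.succ, ?_, ?_⟩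
  · intro h0
    refine hc ?_
    have h1 : ∀ j : Fin d, c j.succ = 0 := fun j => congrFun h0 j
    rw [Fin.sum_univ_succ] at hsum
    simp only [h1, Finset.sum_const_zero, add_zero] at hsum
    ext a
    refine Fin.cases hsum h1 a
  · ext i
    have h2 : ∑ a, c a * (q a i - q 0 i) = 0 := by
      have := congrArg (fun z => z.ofLp i) h
      simp only [WithLp.ofLp_sum, Finset.sum_apply, WithLp.ofLp_smul, Pi.smul_apply, smul_eq_mul,
        WithLp.ofLp_zero, Pi.zero_apply] at this
      simp only [mul_sub, Finset.sum_sub_distrib, ← Finset.sum_mul, hsum, this]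
      simp
    rw [Fin.sum_univ_succ] at h2
    simpa [Matrix.mulVec, dotProduct, mul_comm] using h2

theorem massNorm_nonneg (m : Fin (d + 1) → ℝ) (x : Config d) : 0 ≤ massNorm m x :=
  Real.sqrt_nonneg _

/-- The variance inequality: the centre of mass minimizes the weighted sum of squares. -/
theorem gramForm_le_sum_sq (hm : ∀ a, 0 < m a) (q : Config d) (n : EuclideanSpace ℝ (Fin d))
    (h : ℝ) : gramForm m q n ≤ ∑ a, m a * (inner ℝ n (q a) - h) ^ 2 := by
  have h1 : ∀ a, m a * (inner ℝ n (q a) - h) ^ 2 = m a * inner ℝ n (centered m q a) ^ 2 +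
      2 * (inner ℝ n (centerOfMass m q) - h) * (m a * inner ℝ n (centered m q a)) +
      m a * (inner ℝ n (centerOfMass m q) - h) ^ 2 := by
    intro a
    simp only [centered, inner_sub_right]
    ring
  simp only [h1, Finset.sum_add_distrib, ← Finset.mul_sum, sum_mul_inner_centered hm]
  have : 0 ≤ ∑ a, m a * (inner ℝ n (centerOfMass m q) - h) ^ 2 :=
    Finset.sum_nonneg fun a _ => mul_nonneg (hm a).le (sq_nonneg _)
  unfold gramForm
  linarith

/-- Cauchy–Schwarz for each mass bounds its displacement below by the component along n; the
variance inequality then removes the dependence on the height h. -/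
theorem gramForm_le_massNorm_sq (hm : ∀ a, 0 < m a) (q p : Config d)
    {n : EuclideanSpace ℝ (Fin d)} (hn : ‖n‖ = 1) {h : ℝ} (hp : ∀ a, inner ℝ n (p a) = h) :
    gramForm m q n ≤ massNorm m (q - p) ^ 2 := by
  refine (gramForm_le_sum_sq hm q n h).trans ?_
  rw [massNorm, Real.sq_sqrt]
  · refine Finset.sum_le_sum fun a _ => mul_le_mul_of_nonneg_left ?_ (hm a).le
    rw [← hp a, ← inner_sub_right, Pi.sub_apply, real_inner_self_eq_norm_sq]
    have := abs_real_inner_le_norm n (q a - p a)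
    rw [hn, one_mul] at this
    exact sq_le_sq' (abs_le.mp this).1 (abs_le.mp this).2
  · exact Finset.sum_nonneg fun a _ => mul_nonneg (hm a).le real_inner_self_nonneg

/-- The witness is the orthogonal projection onto the hyperplane with normal n through the centre of
mass. -/
theorem exists_mem_degenerationLocus_massNorm_sq (hm : ∀ a, 0 < m a) (q : Config d)
    {n : EuclideanSpace ℝ (Fin d)} (hn : ‖n‖ = 1) :
    ∃ p ∈ degenerationLocus d, massNorm m (q - p) ^ 2 = gramForm m q n := by
  have hnn : inner ℝ n n = (1 : ℝ) := by rw [real_inner_self_eq_norm_sq, hn, one_pow]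
  refine ⟨fun a => q a - inner ℝ n (centered m q a) • n,
    ⟨n, by rintro rfl; simp at hn, inner ℝ n (centerOfMass m q), fun a => ?_⟩, ?_⟩
  · rw [inner_sub_right, inner_smul_right, hnn, centered, inner_sub_right]
    ring
  · rw [massNorm, Real.sq_sqrt]
    · refine Finset.sum_congr rfl fun a _ => ?_
      simp only [Pi.sub_apply, sub_sub_cancel, inner_smul_left, inner_smul_right, hnn,
        conj_trivial]
      ring
    · exact Finset.sum_nonneg fun a _ => mul_nonneg (hm a).le real_inner_self_nonneg

theorem exists_unit_iInf_massNorm_sq (hd : 1 ≤ d) (hm : ∀ a, 0 < m a) (q : Config d) :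
    ∃ n : EuclideanSpace ℝ (Fin d), ‖n‖ = 1 ∧
      (⨅ p : degenerationLocus d, massNorm m (q - (p : Config d))) ^ 2 = gramForm m q n ∧
      ∀ w : EuclideanSpace ℝ (Fin d), ‖w‖ = 1 → gramForm m q n ≤ gramForm m q w := by
  have : Nonempty (Fin d) := ⟨⟨0, hd⟩⟩
  obtain ⟨n, hn, hmin⟩ := (isCompact_sphere (0 : EuclideanSpace ℝ (Fin d)) 1).exists_isMinOn
    (NormedSpace.sphere_nonempty.mpr zero_le_one) (continuous_gramForm m q).continuousOn
  have hn1 : ‖n‖ = 1 := by simpa using hn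
  have hmin' : ∀ w : EuclideanSpace ℝ (Fin d), ‖w‖ = 1 → gramForm m q n ≤ gramForm m q w :=
    fun w hw => hmin (by simpa using hw)
  refine ⟨n, hn1, ?_, hmin'⟩
  obtain ⟨p, hp, hpn⟩ := exists_mem_degenerationLocus_massNorm_sq hm q hn1
  have hbdd : BddBelow (Set.range fun p : degenerationLocus d => massNorm m (q - (p : Config d))) :=
    ⟨0, by rintro _ ⟨p, rfl⟩; exact massNorm_nonneg _ _⟩
  have hne : Nonempty (degenerationLocus d) := ⟨⟨p, hp⟩⟩
  have h0 : 0 ≤ ⨅ p : degenerationLocus d, massNorm m (q - (p : Config d)) :=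
    le_ciInf fun _ => massNorm_nonneg _ _
  apply le_antisymm
  · rw [← hpn]
    exact pow_le_pow_left₀ h0 (ciInf_le hbdd ⟨p, hp⟩) 2
  · have : Real.sqrt (gramForm m q n) ≤
        ⨅ p : degenerationLocus d, massNorm m (q - (p : Config d)) := by
      refine le_ciInf fun ⟨p, k, hk, h, hp⟩ => Real.sqrt_le_iff.mpr ⟨massNorm_nonneg _ _, ?_⟩
      have hk' : ‖(‖k‖⁻¹ • k)‖ = 1 := norm_smul_inv_norm (𝕜 := ℝ) hk
      refine (hmin' _ hk').trans
        (gramForm_le_massNorm_sq hm q p hk' (h := ‖k‖⁻¹ * h) fun a => ?_)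
      rw [inner_smul_left, hp a]
      simp
    calc gramForm m q n = Real.sqrt (gramForm m q n) ^ 2 :=
          (Real.sq_sqrt (gramForm_nonneg hm q n)).symm
      _ ≤ _ := pow_le_pow_left₀ (Real.sqrt_nonneg _) this 2

theorem gramForm_ne_zero_of_volumeDet_ne_zero (hm : ∀ a, 0 < m a) {q : Config d}
    (hq : volumeDet q ≠ 0) {n : EuclideanSpace ℝ (Fin d)} (hn : ‖n‖ = 1) :
    gramForm m q n ≠ 0 := by
  intro h
  refine hq (volumeDet_eq_zero_of_inner (n := n) (by rintro rfl; simp at hn) fun a b => ?_)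
  have h0 := (Finset.sum_eq_zero_iff_of_nonneg
    fun a _ => mul_nonneg (hm a).le (sq_nonneg _)).mp h
  have h1 : ∀ a, inner ℝ n (centered m q a) = 0 := fun a => by
    simpa [(hm a).ne'] using h0 a (Finset.mem_univ a)
  rw [← centered_sub_centered (m := m), inner_sub_right, h1, h1, sub_zero]

/-- The square of the signed distance is the smallest value of `gramForm` on unit vectors. -/
theorem exists_unit_signedDistance_sq (hd : 1 ≤ d) (hm : ∀ a, 0 < m a) (q : Config d) :
    ∃ n : EuclideanSpace ℝ (Fin d), ‖n‖ = 1 ∧ signedDistance m q ^ 2 = gramForm m q n ∧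
      ∀ w : EuclideanSpace ℝ (Fin d), ‖w‖ = 1 → gramForm m q n ≤ gramForm m q w := by
  obtain ⟨n, hn, hD, hmin⟩ := exists_unit_iInf_massNorm_sq hd hm q
  refine ⟨n, hn, ?_, hmin⟩
  rw [signedDistance, mul_pow, hD]
  -- If the determinant vanishes, the factor `Real.sign` makes S zero, so the minimum itself must be
  -- shown to be zero; a normal of the hyperplane containing q does this.
  by_cases hq : volumeDet q = 0
  · obtain ⟨k, hk, hk0⟩ := exists_inner_of_volumeDet_eq_zero hq
    have h1 : gramForm m q k ≤ 0 := by
      refine (gramForm_le_sum_sq hm q k (inner ℝ k (q 0))).trans (le_of_eq ?_)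
      refine Finset.sum_eq_zero fun a _ => ?_
      rw [← inner_sub_right, hk0]
      simp
    have h2 : gramForm m q n ≤ 0 := by
      refine (hmin (‖k‖⁻¹ • k) (norm_smul_inv_norm (𝕜 := ℝ) hk)).trans ?_
      rw [gramForm_smul]
      exact mul_nonpos_of_nonneg_of_nonpos (sq_nonneg _) h1
    rw [le_antisymm h2 (gramForm_nonneg hm q n), mul_zero]
  · rcases Real.sign_apply_eq_of_ne_zero _ hq with h | h <;> rw [h] <;> norm_num

theorem signedDistance_sq_mul_le (hd : 1 ≤ d) (hm : ∀ a, 0 < m a) (q : Config d)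
    (w : EuclideanSpace ℝ (Fin d)) : signedDistance m q ^ 2 * ‖w‖ ^ 2 ≤ gramForm m q w := by
  obtain ⟨n, hn, hS, hmin⟩ := exists_unit_signedDistance_sq hd hm q
  rcases eq_or_ne w 0 with rfl | hw
  · simpa using gramForm_nonneg hm q 0
  · have h := hmin (‖w‖⁻¹ • w) (norm_smul_inv_norm (𝕜 := ℝ) hw)
    rw [← hS, gramForm_smul, inv_pow, inv_mul_eq_div, le_div_iff₀ (by positivity)] at h
    exact h

theorem signedDistance_ne_zero (hd : 1 ≤ d) (hm : ∀ a, 0 < m a) {q : Config d}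
    (hq : volumeDet q ≠ 0) : signedDistance m q ≠ 0 := by
  obtain ⟨n, hn, hS, -⟩ := exists_unit_signedDistance_sq hd hm q
  intro h
  rw [h] at hS
  exact gramForm_ne_zero_of_volumeDet_ne_zero hm hq hn (by rw [← hS]; norm_num)

theorem signedDistance_eq_zero {q : Config d} (hq : volumeDet q = 0) :
    signedDistance m q = 0 := by
  rw [signedDistance, hq, Real.sign_zero, zero_mul]

/-- A configuration is a limit of configurations off the degeneration locus. -/
theorem exists_seq_volumeDet_ne_zero (q : Config d) :
    ∃ x : ℕ → Config d, Filter.Tendsto x Filter.atTop (𝓝 q) ∧ ∀ k, volumeDet (x k) ≠ 0 := by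
  -- The standard simplex: its edge matrix is the identity, so the determinant along the line q + t
  -- e is a characteristic polynomial in t, monic and hence with finitely many roots.
  let e : Config d := Fin.cons 0 fun j => EuclideanSpace.single j 1
  have hdet : ∀ t : ℝ, volumeDet (q + t • e) =
      (Matrix.charpoly (-Matrix.of fun i j : Fin d => q j.succ i - q 0 i)).eval t := by
    intro t
    rw [Matrix.eval_charpoly, volumeDet]
    congr 1
    ext i j
    simp [e, Matrix.scalar_apply, Matrix.diagonal_apply]
    split_ifs <;> ring
  have hfin : {t : ℝ | volumeDet (q + t • e) = 0}.Finite := by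
    simp only [hdet]
    exact Polynomial.finite_setOfPred_isRoot (Matrix.charpoly_monic _).ne_zero
  have hfreq : ∃ᶠ t in 𝓝 (0 : ℝ), volumeDet (q + t • e) ≠ 0 := by
    have h1 : ∀ᶠ t in 𝓝[≠] (0 : ℝ), volumeDet (q + t • e) ≠ 0 := by
      have h2 : (({t : ℝ | volumeDet (q + t • e) = 0} \ {0})ᶜ) ∈ 𝓝 (0 : ℝ) :=
        (hfin.subset Set.sdiff_subset).isClosed.isOpen_compl.mem_nhds (by simp)
      filter_upwards [nhdsWithin_le_nhds h2, self_mem_nhdsWithin] with t ht ht0 h0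
      exact ht ⟨h0, ht0⟩
    exact h1.frequently.filter_mono nhdsWithin_le_nhds
  obtain ⟨s, hs, hs'⟩ := Filter.exists_seq_forall_of_frequently hfreq
  refine ⟨fun k => q + s k • e, ?_, hs'⟩
  have : Filter.Tendsto (fun t : ℝ => q + t • e) (𝓝 0) (𝓝 (q + (0 : ℝ) • e)) :=
    (by fun_prop : Continuous fun t : ℝ => q + t • e).tendsto 0
  rw [zero_smul, add_zero] at this
  exact this.comp hs

end

/-! ### Singular pairs, the gradient of S, and nondegeneracy where S is smooth -/

section

variable {d : ℕ} {m : Fin (d + 1) → ℝ}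

/-- `n` and `u` are singular vectors of the centred configuration belonging to the singular value
`|S|`, with the sign convention that the differential of `S` at `q` is `n ⊗ u`. -/
structure IsSingularPair (m : Fin (d + 1) → ℝ) (q : Config d) (n : EuclideanSpace ℝ (Fin d))
    (u : Fin (d + 1) → ℝ) : Prop where
  norm_eq : ‖n‖ = 1
  sum_sq : ∑ a, m a * u a ^ 2 = 1
  sum_eq : ∑ a, m a * u a = 0
  inner_centered : ∀ a, inner ℝ n (centered m q a) = signedDistance m q * u a
  sum_smul : ∑ a, (m a * u a) • q a = signedDistance m q • n
  fderiv_apply : ∀ p, fderiv ℝ (signedDistance m) q p = ∑ a, m a * u a * inner ℝ n (p a)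

theorem hasDerivAt_line (q p : Config d) : HasDerivAt (fun t : ℝ => q + t • p) p 0 := by
  simpa using ((hasDerivAt_id (0 : ℝ)).smul_const p).const_add q

theorem hasDerivAt_signedDistance_line {q : Config d}
    (hS : DifferentiableAt ℝ (signedDistance m) q) (p : Config d) :
    HasDerivAt (fun t : ℝ => signedDistance m (q + t • p))
      (fderiv ℝ (signedDistance m) q p) 0 := by
  have h : HasFDerivAt (signedDistance m) (fderiv ℝ (signedDistance m) q) (q + (0 : ℝ) • p) := by
    simpa using hS.hasFDerivAt
  exact h.comp_hasDerivAt (0 : ℝ) (hasDerivAt_line q p)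

theorem hasDerivAt_gramForm_line (hm : ∀ a, 0 < m a) (q p : Config d)
    (n : EuclideanSpace ℝ (Fin d)) :
    HasDerivAt (fun t : ℝ => gramForm m (q + t • p) n)
      (2 * ∑ a, m a * inner ℝ n (centered m q a) * inner ℝ n (p a)) 0 := by
  have h1 : (fun t : ℝ => gramForm m (q + t • p) n) = fun t : ℝ =>
      ∑ a, m a * (inner ℝ n (centered m q a) + t * inner ℝ n (centered m p a)) ^ 2 := by
    ext t
    simp only [gramForm, centered_add_smul, inner_add_right, inner_smul_right]
  have h2 : 2 * ∑ a, m a * inner ℝ n (centered m q a) * inner ℝ n (p a) =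
      ∑ a, m a * (2 * (inner ℝ n (centered m q a) + 0 * inner ℝ n (centered m p a)) *
        inner ℝ n (centered m p a)) := by
    have h3 : ∀ a, m a * inner ℝ n (centered m q a) * inner ℝ n (p a) =
        m a * inner ℝ n (centered m q a) * inner ℝ n (centered m p a) +
        m a * inner ℝ n (centered m q a) * inner ℝ n (centerOfMass m p) := fun a => by
      rw [centered.eq_def m p, inner_sub_right]
      ring
    simp only [h3, Finset.sum_add_distrib, ← Finset.sum_mul, sum_mul_inner_centered hm, zero_mul,
      add_zero, Finset.mul_sum]
    exact Finset.sum_congr rfl fun a _ => by ring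
  rw [h1, h2]
  refine HasDerivAt.fun_sum fun a _ => HasDerivAt.const_mul _ ?_
  simpa using (((hasDerivAt_id (0 : ℝ)).mul_const (inner ℝ n (centered m p a))).const_add
    (inner ℝ n (centered m q a))).fun_pow 2

/-- Envelope argument: with n held fixed, the form minus S² is nonnegative at every configuration
and vanishes at q, so its derivative there is zero. This holds for every minimizer n, which later
forces uniqueness. -/
theorem signedDistance_mul_fderiv (hd : 1 ≤ d) (hm : ∀ a, 0 < m a) {q : Config d}
    (hS : DifferentiableAt ℝ (signedDistance m) q) {n : EuclideanSpace ℝ (Fin d)} (hn : ‖n‖ = 1)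
    (h : gramForm m q n = signedDistance m q ^ 2) (p : Config d) :
    signedDistance m q * fderiv ℝ (signedDistance m) q p =
      ∑ a, m a * inner ℝ n (centered m q a) * inner ℝ n (p a) := by
  have hmin : IsLocalMin
      (fun t : ℝ => gramForm m (q + t • p) n - signedDistance m (q + t • p) ^ 2) 0 := by
    refine Filter.Eventually.of_forall fun t => ?_
    have := signedDistance_sq_mul_le hd hm (q + t • p) n
    rw [hn] at this
    simp only [zero_smul, add_zero, h]
    linarith
  have := hmin.hasDerivAt_eq_zero ((hasDerivAt_gramForm_line hm q p n).sub
    ((hasDerivAt_signedDistance_line hS p).pow 2))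
  simp at this
  linarith

/-- The first order condition for a minimizer of the quadratic form on the unit sphere. -/
theorem sum_inner_smul_centered (hd : 1 ≤ d) (hm : ∀ a, 0 < m a) {q : Config d}
    {n : EuclideanSpace ℝ (Fin d)} (hn : ‖n‖ = 1) (h : gramForm m q n = signedDistance m q ^ 2) :
    ∑ a, (m a * inner ℝ n (centered m q a)) • centered m q a = signedDistance m q ^ 2 • n := by
  refine ext_inner_left ℝ fun w => ?_
  -- By homogeneity the constraint ‖n‖ = 1 is replaced by the multiplier S², so the direction w is
  -- unrestricted.
  have hmin : IsLocalMin (fun t : ℝ => gramForm m q (n + t • w) -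
      signedDistance m q ^ 2 * ‖n + t • w‖ ^ 2) 0 := by
    refine Filter.Eventually.of_forall fun t => ?_
    have := signedDistance_sq_mul_le hd hm q (n + t • w)
    simp only [zero_smul, add_zero, h, hn]
    linarith
  have hd0 : HasDerivAt (fun t : ℝ => n + t • w) w 0 := by
    simpa using ((hasDerivAt_id (0 : ℝ)).smul_const w).const_add n
  have hd1 : HasDerivAt (fun t : ℝ => gramForm m q (n + t • w))
      (∑ a, m a * (2 * inner ℝ n (centered m q a) * inner ℝ w (centered m q a))) 0 := by
    refine HasDerivAt.fun_sum fun a _ => HasDerivAt.const_mul _ ?_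
    simpa using (hd0.inner ℝ (hasDerivAt_const (0 : ℝ) (centered m q a))).fun_pow 2
  have := hmin.hasDerivAt_eq_zero (hd1.sub ((hd0.norm_sq).const_mul (signedDistance m q ^ 2)))
  simp only [zero_smul, add_zero] at this
  have h2 : ∑ a, m a * (2 * inner ℝ n (centered m q a) * inner ℝ w (centered m q a)) =
      2 * ∑ a, m a * inner ℝ n (centered m q a) * inner ℝ w (centered m q a) := by
    rw [Finset.mul_sum]
    exact Finset.sum_congr rfl fun a _ => by ring
  rw [h2, real_inner_comm] at this
  simp only [inner_sum, inner_smul_right]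
  linarith

theorem exists_isSingularPair_of_ne_zero (hd : 1 ≤ d) (hm : ∀ a, 0 < m a) {q : Config d}
    (hS : DifferentiableAt ℝ (signedDistance m) q) (h0 : signedDistance m q ≠ 0) :
    ∃ n u, IsSingularPair m q n u := by
  obtain ⟨n, hn, hn2, -⟩ := exists_unit_signedDistance_sq hd hm q
  have hsum : ∑ a, m a * ((signedDistance m q)⁻¹ * inner ℝ n (centered m q a)) = 0 := by
    simp only [mul_left_comm _ (signedDistance m q)⁻¹, ← Finset.mul_sum,
      sum_mul_inner_centered hm, mul_zero]
  refine ⟨n, fun a => (signedDistance m q)⁻¹ * inner ℝ n (centered m q a), hn, ?_, hsum, ?_, ?_, ?_⟩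
  · simp only [mul_pow, mul_left_comm _ ((signedDistance m q)⁻¹ ^ 2), ← Finset.mul_sum]
    rw [← gramForm, ← hn2, inv_pow, inv_mul_cancel₀ (pow_ne_zero 2 h0)]
  · intro a
    rw [mul_inv_cancel_left₀ h0]
  · rw [← sum_smul_centered_of_sum_eq_zero (m := m) q hsum]
    simp only [mul_left_comm _ (signedDistance m q)⁻¹, mul_smul _ (_ * _), ← Finset.smul_sum]
    rw [sum_inner_smul_centered hd hm hn hn2.symm, smul_smul, sq, inv_mul_cancel_left₀ h0]
  · intro p
    have := signedDistance_mul_fderiv hd hm hS hn hn2.symm p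
    simp only [mul_left_comm _ (signedDistance m q)⁻¹, mul_assoc _ (_ * _), ← Finset.mul_sum]
    rw [← this, inv_mul_cancel_left₀ h0]

theorem IsSingularPair.abs_le (hm : ∀ a, 0 < m a) {q : Config d}
    {n : EuclideanSpace ℝ (Fin d)} {u : Fin (d + 1) → ℝ} (h : IsSingularPair m q n u)
    (a : Fin (d + 1)) : |u a| ≤ Real.sqrt (m a)⁻¹ := by
  refine Real.abs_le_sqrt ?_
  have h1 : m a * u a ^ 2 ≤ 1 := h.sum_sq ▸ Finset.single_le_sum
    (f := fun a => m a * u a ^ 2) (fun a _ => mul_nonneg (hm a).le (sq_nonneg _))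
    (Finset.mem_univ a)
  rw [inv_eq_one_div, le_div_iff₀ (hm a)]
  linarith

/-- At S = 0 one cannot divide by S to define u. Instead q is approached by nondegenerate
configurations; their pairs lie in a compact set, and every defining identity passes to the limit
because S and dS are continuous. -/
theorem exists_isSingularPair (hd : 1 ≤ d) (hm : ∀ a, 0 < m a) {q : Config d}
    (hS : ContDiffAt ℝ 1 (signedDistance m) q) : ∃ n u, IsSingularPair m q n u := by
  obtain ⟨x, hx, hx0⟩ := exists_seq_volumeDet_ne_zero q
  have hev : ∀ᶠ k in Filter.atTop, ContDiffAt ℝ 1 (signedDistance m) (x k) :=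
    hx.eventually (hS.eventually (by simp))
  obtain ⟨N, hN⟩ := Filter.eventually_atTop.mp hev
  have hpair : ∀ k, ∃ z : EuclideanSpace ℝ (Fin d) × (Fin (d + 1) → ℝ),
      IsSingularPair m (x (k + N)) z.1 z.2 := fun k => by
    obtain ⟨n, u, h⟩ := exists_isSingularPair_of_ne_zero hd hm
      ((hN (k + N) (Nat.le_add_left _ _)).differentiableAt one_ne_zero)
      (signedDistance_ne_zero hd hm (hx0 (k + N)))
    exact ⟨(n, u), h⟩
  choose z hz using hpair
  have hK : IsCompact (Metric.sphere (0 : EuclideanSpace ℝ (Fin d)) 1 ×ˢ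
      Set.pi Set.univ fun a : Fin (d + 1) => Set.Icc (-Real.sqrt (m a)⁻¹) (Real.sqrt (m a)⁻¹)) :=
    (isCompact_sphere _ _).prod (isCompact_univ_pi fun _ => isCompact_Icc)
  obtain ⟨⟨n, u⟩, -, φ, hφ, hlim⟩ := hK.tendsto_subseq (x := z) fun k =>
    ⟨by simpa using (hz k).norm_eq, fun a _ => abs_le.mp ((hz k).abs_le hm a)⟩
  have hn : Filter.Tendsto (fun k => (z (φ k)).1) Filter.atTop (𝓝 n) :=
    (continuous_fst.tendsto _).comp hlim
  have hu : ∀ a, Filter.Tendsto (fun k => (z (φ k)).2 a) Filter.atTop (𝓝 (u a)) := fun a =>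
    (((continuous_apply a).comp continuous_snd).tendsto (n, u)).comp hlim
  have hy : Filter.Tendsto (fun k => x (φ k + N)) Filter.atTop (𝓝 q) :=
    hx.comp ((Filter.tendsto_add_atTop_nat N).comp hφ.tendsto_atTop)
  have hya : ∀ a, Filter.Tendsto (fun k => x (φ k + N) a) Filter.atTop (𝓝 (q a)) := fun a =>
    ((continuous_apply a).tendsto q).comp hy
  have hSl : Filter.Tendsto (fun k => signedDistance m (x (φ k + N))) Filter.atTop
      (𝓝 (signedDistance m q)) := hS.continuousAt.tendsto.comp hy
  have hSd : Filter.Tendsto (fun k => fderiv ℝ (signedDistance m) (x (φ k + N))) Filter.atTop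
      (𝓝 (fderiv ℝ (signedDistance m) q)) :=
    (hS.continuousAt_fderiv one_ne_zero).tendsto.comp hy
  have hp := fun k => hz (φ k)
  refine ⟨n, u, ?_, ?_, ?_, fun a => ?_, ?_, fun p => ?_⟩
  · refine tendsto_nhds_unique hn.norm ?_
    simp only [(hp _).norm_eq, tendsto_const_nhds]
  · refine tendsto_nhds_unique
      (tendsto_finsetSum _ fun a _ => ((hu a).pow 2).const_mul (m a)) ?_
    simp only [(hp _).sum_sq, tendsto_const_nhds]
  · refine tendsto_nhds_unique (tendsto_finsetSum _ fun a _ => (hu a).const_mul (m a)) ?_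
    simp only [(hp _).sum_eq, tendsto_const_nhds]
  · refine tendsto_nhds_unique
      (hn.inner (((continuous_centered m a).tendsto q).comp hy)) ?_
    simp only [Function.comp_def, (hp _).inner_centered]
    exact hSl.mul (hu a)
  · refine tendsto_nhds_unique
      (tendsto_finsetSum _ fun a _ => ((hu a).const_mul (m a)).smul (hya a)) ?_
    simp only [(hp _).sum_smul]
    exact hSl.smul hn
  · refine tendsto_nhds_unique
      (((ContinuousLinearMap.apply ℝ ℝ p).continuous.tendsto _).comp hSd) ?_
    simp only [Function.comp_def, ContinuousLinearMap.apply_apply, (hp _).fderiv_apply]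
    exact tendsto_finsetSum _ fun a _ =>
      ((hu a).const_mul (m a)).mul (hn.inner tendsto_const_nhds)

variable {q : Config d} {n : EuclideanSpace ℝ (Fin d)} {u : Fin (d + 1) → ℝ}

namespace IsSingularPair

theorem inner_self (h : IsSingularPair m q n u) : inner ℝ n n = (1 : ℝ) := by
  rw [real_inner_self_eq_norm_sq, h.norm_eq, one_pow]

theorem fderiv_smul (h : IsSingularPair m q n u) (w : EuclideanSpace ℝ (Fin d)) :
    fderiv ℝ (signedDistance m) q (fun a => u a • w) = inner ℝ n w := by
  have h1 : ∀ a, m a * u a * inner ℝ n (u a • w) = (m a * u a ^ 2) * inner ℝ n w := fun a => by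
    rw [inner_smul_right]
    ring
  rw [h.fderiv_apply]
  simp only [h1, ← Finset.sum_mul, h.sum_sq, one_mul]

/-- The derivative of S in the direction u ⊗ n is 1, so S cannot vanish identically on that line.
This gives nondegeneracy information even when q itself is degenerate. -/
theorem exists_volumeDet_ne_zero (h : IsSingularPair m q n u)
    (hS : DifferentiableAt ℝ (signedDistance m) q) :
    ∃ t : ℝ, volumeDet (q + t • (fun a => u a • n : Config d)) ≠ 0 := by
  by_contra! hdet
  have h1 := hasDerivAt_signedDistance_line hS (fun a => u a • n)
  simp only [signedDistance_eq_zero (hdet _), h.fderiv_smul, h.inner_self] at h1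
  exact one_ne_zero (h1.unique (hasDerivAt_const _ _))

/-- Constants, u and the coordinates of q together span all functions on the d + 1 masses: a nonzero
b orthogonal to them would be an affine dependence among the points of every q + t (u ⊗ n), making
the whole line degenerate. -/
theorem eq_zero_of_sum (hm : ∀ a, 0 < m a) (h : IsSingularPair m q n u)
    (hS : DifferentiableAt ℝ (signedDistance m) q) {b : Fin (d + 1) → ℝ}
    (hb : ∑ a, m a * b a = 0) (hbu : ∑ a, m a * b a * u a = 0)
    (hbq : ∑ a, (m a * b a) • q a = 0) : b = 0 := by
  by_contra hne
  obtain ⟨t, ht⟩ := h.exists_volumeDet_ne_zero hS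
  refine ht (volumeDet_eq_zero_of_sum (c := fun a => m a * b a) (fun h0 => hne ?_) hb ?_)
  · ext a
    simpa [(hm a).ne'] using congrFun h0 a
  · simp only [Pi.add_apply, Pi.smul_apply, smul_add, Finset.sum_add_distrib, hbq, zero_add,
      smul_smul, ← Finset.sum_smul, mul_left_comm _ t, ← mul_assoc]
    simp only [mul_assoc t, ← Finset.mul_sum, hbu, mul_zero, zero_smul]

/-- Simplicity of the least eigenvalue. If S ≠ 0, a second minimizer w ⊥ n would, by the envelope
formula, give derivative 0 along u ⊗ n, where it is 1. If S = 0, w would be normal to a hyperplane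
containing each q + t (u ⊗ n), so the whole line would be degenerate. -/
theorem eq_zero_of_gramForm (hd : 1 ≤ d) (hm : ∀ a, 0 < m a) (h : IsSingularPair m q n u)
    (hS : DifferentiableAt ℝ (signedDistance m) q) {w : EuclideanSpace ℝ (Fin d)}
    (hw : inner ℝ n w = 0) (hg : gramForm m q w = signedDistance m q ^ 2 * ‖w‖ ^ 2) :
    w = 0 := by
  by_contra hne
  by_cases h0 : signedDistance m q = 0
  · obtain ⟨t, ht⟩ := h.exists_volumeDet_ne_zero hS
    refine ht (volumeDet_eq_zero_of_inner hne fun a b => ?_)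
    have h1 := (Finset.sum_eq_zero_iff_of_nonneg
      fun a _ => mul_nonneg (hm a).le (sq_nonneg _)).mp
      (hg.trans (by rw [h0]; norm_num))
    have h2 : ∀ a, inner ℝ w (centered m q a) = 0 := fun a => by
      simpa [(hm a).ne'] using h1 a (Finset.mem_univ a)
    rw [← centered_sub_centered (m := m), centered_add_smul, centered_add_smul]
    have h3 : ∀ a, inner ℝ w (centered m (fun a => u a • n : Config d) a) = 0 := fun a => by
      rw [centered, centerOfMass]
      simp [inner_sub_right, inner_smul_right, inner_sum, real_inner_comm, hw]
    simp only [inner_sub_right, inner_add_right, inner_smul_right, h2, h3]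
    simp
  · have hk : ‖(‖w‖⁻¹ • w)‖ = 1 := norm_smul_inv_norm (𝕜 := ℝ) hne
    have h1 := signedDistance_mul_fderiv hd hm hS hk
      (by rw [gramForm_smul, hg]; field_simp) (fun a => u a • n)
    rw [h.fderiv_smul, h.inner_self] at h1
    simp [inner_smul_left, inner_smul_right, real_inner_comm, hw] at h1
    exact h0 h1

end IsSingularPair

end

/-! ### Dependence of the singular pair on the configuration, and the gap operator -/

section

variable {d : ℕ} {m : Fin (d + 1) → ℝ} {q : Config d} {n : EuclideanSpace ℝ (Fin d)}
  {u : Fin (d + 1) → ℝ}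

namespace IsSingularPair

theorem neg (h : IsSingularPair m q n u) : IsSingularPair m q (-n) (-u) where
  norm_eq := by rw [norm_neg, h.norm_eq]
  sum_sq := by simpa using h.sum_sq
  sum_eq := by simpa using h.sum_eq
  inner_centered a := by simp [h.inner_centered a]
  sum_smul := by simp [h.sum_smul]
  fderiv_apply p := by simp [h.fderiv_apply p]

theorem fderiv_smul_apply (h : IsSingularPair m q n u) (b : Fin (d + 1) → ℝ)
    (w : EuclideanSpace ℝ (Fin d)) :
    fderiv ℝ (signedDistance m) q (fun a => b a • w) = (∑ a, m a * u a * b a) * inner ℝ n w := by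
  rw [h.fderiv_apply, Finset.sum_mul]
  refine Finset.sum_congr rfl fun a _ => ?_
  rw [inner_smul_right]
  ring

theorem fderiv_single (h : IsSingularPair m q n u) (a : Fin (d + 1))
    (w : EuclideanSpace ℝ (Fin d)) :
    fderiv ℝ (signedDistance m) q (Pi.single a w) = m a * u a * inner ℝ n w := by
  rw [h.fderiv_apply, Finset.sum_eq_single a]
  · simp
  · intro b _ hb
    simp [hb]
  · simp

theorem smul_of_abs_eq_one (h : IsSingularPair m q n u) {c : ℝ} (hc : |c| = 1) :
    IsSingularPair m q (c • n) (c • u) := by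
  rcases eq_or_eq_neg_of_abs_eq hc with rfl | rfl
  · simpa using h
  · simpa using h.neg

/-- Both pairs factor the same rank-one tensor dS = n ⊗ u, and the normalizations leave only a
common sign. -/
theorem eq_or_eq_neg (hm : ∀ a, 0 < m a) (h : IsSingularPair m q n u)
    {n' : EuclideanSpace ℝ (Fin d)} {u' : Fin (d + 1) → ℝ} (h' : IsSingularPair m q n' u') :
    (n' = n ∧ u' = u) ∨ (n' = -n ∧ u' = -u) := by
  have hn : n' = (∑ a, m a * u a * u' a) • n := by
    refine ext_inner_right ℝ fun w => ?_
    rw [← h'.fderiv_smul, h.fderiv_smul_apply, inner_smul_left, conj_trivial]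
  set c := ∑ a, m a * u a * u' a
  have hu : u' = c • u := by
    ext a
    have h1 := h'.fderiv_single a n'
    rw [h.fderiv_single, h'.inner_self, hn, inner_smul_right, h.inner_self] at h1
    have h2 : m a * (u' a - c * u a) = 0 := by linarith
    simpa [(hm a).ne', sub_eq_zero] using h2
  have hc : |c| = 1 := by
    have := h'.norm_eq
    rwa [hn, norm_smul, h.norm_eq, mul_one, Real.norm_eq_abs] at this
  rcases eq_or_eq_neg_of_abs_eq hc with hc | hc <;> rw [hc] at hn hu
  · exact Or.inl (by simpa using And.intro hn hu)
  · exact Or.inr (by simpa using And.intro hn hu)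

/-- A singular pair extends differentiably to the neighbouring configurations. -/
theorem exists_differentiableAt (hd : 1 ≤ d) (hm : ∀ a, 0 < m a) (h : IsSingularPair m q n u)
    (hS : ContDiffAt ℝ 2 (signedDistance m) q) :
    ∃ (ν : Config d → EuclideanSpace ℝ (Fin d)) (μ : Config d → Fin (d + 1) → ℝ),
      DifferentiableAt ℝ ν q ∧ DifferentiableAt ℝ μ q ∧ ν q = n ∧ μ q = u ∧
      ∀ᶠ y in 𝓝 q, IsSingularPair m y (ν y) (μ y) := by
  let e := EuclideanSpace.basisFun (Fin d) ℝ
  -- Contracting dS(y) with the fixed vector u gives a multiple of the normal at y that equals n at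
  -- q. Normalizing it fixes the sign of the normal near q, and contracting dS(y) with the result
  -- recovers the other singular vector.
  let F : Config d → EuclideanSpace ℝ (Fin d) := fun y =>
    ∑ i, fderiv ℝ (signedDistance m) y (fun a => u a • e i) • e i
  have hdS : DifferentiableAt ℝ (fderiv ℝ (signedDistance m)) q :=
    (hS.fderiv_right (m := 1) (by norm_num)).differentiableAt one_ne_zero
  have hF : ∀ {y n' u'}, IsSingularPair m y n' u' → F y = (∑ a, m a * u' a * u a) • n' := by
    intro y n' u' h'
    simp only [F, h'.fderiv_smul_apply, mul_smul, ← Finset.smul_sum]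
    congr 1
    conv_rhs => rw [← e.sum_repr' n']
    exact Finset.sum_congr rfl fun i _ => by rw [real_inner_comm]
  have hFq : F q = n := by
    have : ∑ a, m a * u a * u a = 1 := by
      rw [← h.sum_sq]
      exact Finset.sum_congr rfl fun a _ => by ring
    rw [hF h, this, one_smul]
  have hFd : DifferentiableAt ℝ F q :=
    DifferentiableAt.fun_sum fun i _ =>
      (hdS.clm_apply (differentiableAt_const _)).smul_const _
  have hF0 : F q ≠ 0 := by
    rw [hFq]
    rintro rfl
    simpa using h.norm_eq
  let ν : Config d → EuclideanSpace ℝ (Fin d) := fun y => ‖F y‖⁻¹ • F y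
  let μ : Config d → Fin (d + 1) → ℝ := fun y a =>
    (m a)⁻¹ * fderiv ℝ (signedDistance m) y (Pi.single a (ν y))
  have hμ : ∀ {y n' u'}, IsSingularPair m y n' u' → μ y = inner ℝ n' (ν y) • u' := by
    intro y n' u' h'
    ext a
    simp only [μ, h'.fderiv_single, Pi.smul_apply, smul_eq_mul]
    field_simp [(hm a).ne']
  have hνd : DifferentiableAt ℝ ν q := ((hFd.norm ℝ hF0).inv (norm_ne_zero_iff.mpr hF0)).smul hFd
  have hνq : ν q = n := by simp [ν, hFq, h.norm_eq]
  refine ⟨ν, μ, hνd, differentiableAt_pi.mpr fun a => (hdS.clm_apply ?_).const_mul _, hνq, ?_, ?_⟩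
  · exact ((ContinuousLinearMap.single ℝ (fun _ : Fin (d + 1) => EuclideanSpace ℝ (Fin d))
      a).differentiableAt).comp q hνd
  · rw [hμ h, hνq, h.inner_self, one_smul]
  · filter_upwards [hS.eventually (by simp), hFd.continuousAt.eventually_ne hF0] with y hy hy0
    obtain ⟨n', u', h'⟩ := exists_isSingularPair hd hm (hy.of_le (by norm_num))
    set c := ∑ a, m a * u' a * u a with hc
    have hc0 : c ≠ 0 := by
      intro h0
      exact hy0 (by rw [hF h', ← hc, h0, zero_smul])
    have hν : ν y = (|c|⁻¹ * c) • n' := by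
      simp only [ν, hF h', ← hc, norm_smul, h'.norm_eq, mul_one, Real.norm_eq_abs, smul_smul]
    rw [hμ h', hν, inner_smul_right, h'.inner_self, mul_one]
    refine h'.smul_of_abs_eq_one ?_
    rw [abs_mul, abs_inv, abs_abs, inv_mul_cancel₀ (abs_ne_zero.mpr hc0)]

end IsSingularPair

/-- The symmetric operator `A + n ⊗ n - s`, where `A` is the operator of the form `gramForm`. -/
def gapMap (m : Fin (d + 1) → ℝ) (q : Config d) (n : EuclideanSpace ℝ (Fin d)) (s : ℝ) :
    EuclideanSpace ℝ (Fin d) →L[ℝ] EuclideanSpace ℝ (Fin d) :=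
  ∑ a, m a • InnerProductSpace.rankOne ℝ (centered m q a) (centered m q a) +
    InnerProductSpace.rankOne ℝ n n - s • 1

theorem gapMap_apply (s : ℝ) (w : EuclideanSpace ℝ (Fin d)) :
    gapMap m q n s w = ∑ a, (m a * inner ℝ w (centered m q a)) • centered m q a +
      inner ℝ n w • n - s • w := by
  simp [gapMap, smul_smul, real_inner_comm]

theorem inner_gapMap (s : ℝ) (w z : EuclideanSpace ℝ (Fin d)) :
    inner ℝ z (gapMap m q n s w) =
      ∑ a, m a * inner ℝ w (centered m q a) * inner ℝ z (centered m q a) +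
        inner ℝ n w * inner ℝ n z - s * inner ℝ z w := by
  simp only [gapMap_apply, inner_sub_right, inner_add_right, inner_sum, inner_smul_right,
    real_inner_comm z n]

theorem inner_gapMap_comm (s : ℝ) (w z : EuclideanSpace ℝ (Fin d)) :
    inner ℝ z (gapMap m q n s w) = inner ℝ (gapMap m q n s z) w := by
  rw [real_inner_comm w (gapMap m q n s z), inner_gapMap, inner_gapMap, real_inner_comm z w]
  congr 2
  · exact Finset.sum_congr rfl fun a _ => by ring
  · ring

theorem inner_self_gapMap (s : ℝ) (w : EuclideanSpace ℝ (Fin d)) :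
    inner ℝ w (gapMap m q n s w) = gramForm m q w + inner ℝ n w ^ 2 - s * ‖w‖ ^ 2 := by
  rw [inner_gapMap, gramForm, real_inner_self_eq_norm_sq]
  congr 2
  · exact Finset.sum_congr rfl fun a _ => by ring
  · ring

theorem gapMap_neg (s : ℝ) : gapMap m q (-n) s = gapMap m q n s := by
  ext1 w
  simp [gapMap_apply]

theorem inner_self_gapMap_nonneg (hd : 1 ≤ d) (hm : ∀ a, 0 < m a) {s : ℝ}
    (hs : s ≤ signedDistance m q ^ 2) (w : EuclideanSpace ℝ (Fin d)) :
    0 ≤ inner ℝ w (gapMap m q n s w) := by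
  rw [inner_self_gapMap]
  nlinarith [signedDistance_sq_mul_le hd hm q w, sq_nonneg (inner ℝ n w),
    mul_le_mul_of_nonneg_right hs (sq_nonneg ‖w‖)]

/-- For w in the kernel, w·Aw ≥ S²‖w‖² ≥ s‖w‖² forces w ⊥ n and equality throughout, so w is zero by
simplicity of the least eigenvalue. Adding n ⊗ n is what removes n from the kernel at s = S². -/
theorem isUnit_gapMap (hd : 1 ≤ d) (hm : ∀ a, 0 < m a) (h : IsSingularPair m q n u)
    (hS : DifferentiableAt ℝ (signedDistance m) q) {s : ℝ} (hs : s ≤ signedDistance m q ^ 2) :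
    IsUnit (gapMap m q n s) := by
  have hinj : Function.Injective (gapMap m q n s) := by
    refine (injective_iff_map_eq_zero _).mpr fun w hw => ?_
    have h1 := inner_self_gapMap (m := m) (q := q) (n := n) s w
    rw [hw, inner_zero_right] at h1
    have h2 := signedDistance_sq_mul_le hd hm q w
    have h3 := mul_le_mul_of_nonneg_right hs (sq_nonneg ‖w‖)
    have h4 := sq_nonneg (inner ℝ n w)
    have h5 : inner ℝ n w ^ 2 = 0 := by linarith
    exact h.eq_zero_of_gramForm hd hm hS (pow_eq_zero_iff two_ne_zero |>.mp h5) (by linarith)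
  exact ContinuousLinearMap.isUnit_iff_bijective.mpr
    ⟨hinj, (LinearMap.injective_iff_surjective (f := (gapMap m q n s).toLinearMap)).mp hinj⟩

theorem gapMap_inverse_apply {s : ℝ} (h : IsUnit (gapMap m q n s))
    (w : EuclideanSpace ℝ (Fin d)) : gapMap m q n s (Ring.inverse (gapMap m q n s) w) = w := by
  rw [← mul_apply_eq_comp, Ring.mul_inverse_cancel _ h, one_apply_eq_self]

/-- The part orthogonal to `n` of the vector `∑ mₐ uₐ vₐ`. -/
def transverseVelocity (m : Fin (d + 1) → ℝ) (n : EuclideanSpace ℝ (Fin d))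
    (u : Fin (d + 1) → ℝ) (v : Config d) : EuclideanSpace ℝ (Fin d) :=
  ∑ a, (m a * u a) • v a - inner ℝ n (∑ a, (m a * u a) • v a) • n

/-- The factor `h` in `D²S(v, v) = -S h` for velocities of zero angular momentum. -/
def hessianCoefficient (m : Fin (d + 1) → ℝ) (q : Config d) (n : EuclideanSpace ℝ (Fin d))
    (u : Fin (d + 1) → ℝ) (v : Config d) : ℝ :=
  4 * inner ℝ (transverseVelocity m n u v)
      (Ring.inverse (gapMap m q n (signedDistance m q ^ 2)) (transverseVelocity m n u v)) -
    inner ℝ (transverseVelocity m n u v)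
      (Ring.inverse (gapMap m q n 0) (transverseVelocity m n u v))

theorem hessianCoefficient_neg (v : Config d) :
    hessianCoefficient m q (-n) (-u) v = hessianCoefficient m q n u v := by
  have : transverseVelocity m (-n) (-u) v = -transverseVelocity m n u v := by
    simp [transverseVelocity]
    abel
  simp only [hessianCoefficient, this, gapMap_neg, map_neg, inner_neg_left, inner_neg_right,
    neg_neg]

theorem gapMap_zero_apply (s : ℝ) (w : EuclideanSpace ℝ (Fin d)) :
    gapMap m q n s w = gapMap m q n 0 w - s • w := by
  simp [gapMap_apply]

/-- Inversion reverses the order 0 ≤ K_{S²} ≤ K₀, so b·K₀⁻¹b ≤ b·K_{S²}⁻¹b and the coefficient is at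
least 3 b·K_{S²}⁻¹b. With ξ and ζ the two preimages of b, the comparison comes from K_{S²}(ξ - ζ) =
S² ζ. -/
theorem hessianCoefficient_nonneg (hd : 1 ≤ d) (hm : ∀ a, 0 < m a) (h : IsSingularPair m q n u)
    (hS : DifferentiableAt ℝ (signedDistance m) q) (v : Config d) :
    0 ≤ hessianCoefficient m q n u v := by
  set b := transverseVelocity m n u v with hb
  set s := signedDistance m q ^ 2 with hs
  have hs0 : 0 ≤ s := sq_nonneg _
  set ξ := Ring.inverse (gapMap m q n s) b with hξ
  set ζ := Ring.inverse (gapMap m q n 0) b with hζ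
  have h1 : gapMap m q n s ξ = b := gapMap_inverse_apply (isUnit_gapMap hd hm h hS le_rfl) b
  have h2 : gapMap m q n 0 ζ = b := gapMap_inverse_apply (isUnit_gapMap hd hm h hS hs0) b
  have h3 : 0 ≤ inner ℝ ξ b := h1 ▸ inner_self_gapMap_nonneg hd hm le_rfl ξ
  have h4 : gapMap m q n s (ξ - ζ) = s • ζ := by
    rw [map_sub, h1, gapMap_zero_apply s ζ, h2, sub_sub_cancel]
  have h5 : 0 ≤ inner ℝ (ξ - ζ) (s • ζ) := h4 ▸ inner_self_gapMap_nonneg hd hm le_rfl (ξ - ζ)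
  have h6 : inner ℝ ξ b = inner ℝ ξ (gapMap m q n s ζ) + s * inner ℝ ξ ζ := by
    rw [gapMap_zero_apply s ζ, h2, inner_sub_right, inner_smul_right]
    ring
  rw [inner_gapMap_comm, h1, real_inner_comm ζ b] at h6
  rw [inner_smul_right, inner_sub_left, mul_sub] at h5
  have h7 : 0 ≤ s * inner ℝ ζ ζ := mul_nonneg hs0 real_inner_self_nonneg
  rw [hessianCoefficient, ← hb, ← hs, ← hξ, ← hζ, real_inner_comm ξ b, real_inner_comm ζ b]
  linarith

end

/-! ### The Hessian of S in directions of zero angular momentum -/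

section

variable {d : ℕ} {m : Fin (d + 1) → ℝ} {q : Config d} {n : EuclideanSpace ℝ (Fin d)}
  {u : Fin (d + 1) → ℝ}

/-- Angular momentum is the antisymmetric part of ∑ mₐ xₐ ⊗ vₐ in centred variables, so its
vanishing is symmetry of this bilinear form. -/
theorem sum_inner_mul_inner_of_angularMomentum_eq_zero {v : Config d}
    (hJ : angularMomentum m q v = 0) (y z : EuclideanSpace ℝ (Fin d)) :
    ∑ a, m a * inner ℝ y (centered m v a) * inner ℝ z (centered m q a) =
      ∑ a, m a * inner ℝ y (centered m q a) * inner ℝ z (centered m v a) := by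
  have hJ' : ∀ i j, ∑ a, m a * centered m q a i * centered m v a j =
      ∑ a, m a * centered m q a j * centered m v a i := by
    intro i j
    have := congrFun (congrFun hJ i) j
    simp only [angularMomentum, Matrix.of_apply, Matrix.zero_apply, mul_sub,
      Finset.sum_sub_distrib, sub_eq_zero, ← mul_assoc] at this
    exact this
  have key : ∀ x w : Fin (d + 1) → EuclideanSpace ℝ (Fin d),
      ∑ a, m a * inner ℝ y (x a) * inner ℝ z (w a) =
        ∑ i, ∑ j, y i * z j * ∑ a, m a * x a i * w a j := by
    intro x w
    simp only [PiLp.inner_apply, RCLike.inner_apply, conj_trivial, Finset.mul_sum, Finset.sum_mul]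
    rw [Finset.sum_comm]
    refine (Finset.sum_congr rfl fun i _ => Finset.sum_comm).trans ?_
    rw [Finset.sum_comm]
    refine Finset.sum_congr rfl fun i _ => Finset.sum_congr rfl fun j _ =>
      Finset.sum_congr rfl fun a _ => by ring
  rw [key, key]
  refine Finset.sum_congr rfl fun i _ => Finset.sum_congr rfl fun j _ => ?_
  congr 1
  rw [hJ' i j]
  exact Finset.sum_congr rfl fun a _ => by ring

theorem sum_smul_centered_of_angularMomentum_eq_zero {v : Config d}
    (hJ : angularMomentum m q v = 0) (y : EuclideanSpace ℝ (Fin d)) :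
    ∑ a, (m a * inner ℝ y (centered m v a)) • centered m q a =
      ∑ a, (m a * inner ℝ y (centered m q a)) • centered m v a := by
  refine ext_inner_left ℝ fun z => ?_
  simpa only [inner_sum, inner_smul_right] using
    sum_inner_mul_inner_of_angularMomentum_eq_zero hJ y z

namespace IsSingularPair

theorem inner_gapMap_zero (h : IsSingularPair m q n u) (w : EuclideanSpace ℝ (Fin d)) :
    inner ℝ n (gapMap m q n 0 w) = (signedDistance m q ^ 2 + 1) * inner ℝ n w := by
  have h1 := congrArg (fun z => inner ℝ w z)
    ((sum_smul_centered_of_sum_eq_zero (m := m) q h.sum_eq).trans h.sum_smul)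
  simp only [inner_sum, inner_smul_right, real_inner_comm n w] at h1
  have h2 : ∀ a, m a * inner ℝ w (centered m q a) * inner ℝ n (centered m q a) =
      signedDistance m q * (m a * u a * inner ℝ w (centered m q a)) := fun a => by
    rw [h.inner_centered]
    ring
  rw [inner_gapMap]
  simp only [h2, ← Finset.mul_sum, h1, h.inner_self]
  ring

/-- The second derivative of `S` in a direction of zero angular momentum, in terms of the
derivatives `n'` and `u'` of the singular vectors. -/
theorem hessian_eq (hd : 1 ≤ d) (hm : ∀ a, 0 < m a) (h : IsSingularPair m q n u)
    (hS : DifferentiableAt ℝ (signedDistance m) q) {v : Config d}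
    (hJ : angularMomentum m q v = 0) {n' : EuclideanSpace ℝ (Fin d)} {u' : Fin (d + 1) → ℝ}
    {σ : ℝ} (h1 : inner ℝ n n' = 0) (h2 : ∑ a, m a * u a * u' a = 0) (h3 : ∑ a, m a * u' a = 0)
    (h4 : ∀ a, inner ℝ n' (centered m q a) + inner ℝ n (centered m v a) =
      σ * u a + signedDistance m q * u' a)
    (h5 : ∑ a, (m a * u' a) • q a + ∑ a, (m a * u a) • v a = σ • n + signedDistance m q • n') :
    inner ℝ n' (∑ a, (m a * u a) • v a) + ∑ a, m a * u' a * inner ℝ n (v a) =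
      -signedDistance m q * hessianCoefficient m q n u v := by
  set S := signedDistance m q with hSdef
  set V := ∑ a, (m a * u a) • v a with hV
  have hVc : ∑ a, (m a * u a) • centered m v a = V :=
    sum_smul_centered_of_sum_eq_zero v h.sum_eq
  have huq : ∑ a, (m a * u a) • centered m q a = S • n :=
    (sum_smul_centered_of_sum_eq_zero q h.sum_eq).trans h.sum_smul
  have hu'q : ∑ a, (m a * u' a) • centered m q a = σ • n + S • n' - V := by
    rw [sum_smul_centered_of_sum_eq_zero q h3, eq_sub_iff_add_eq, h5]
  have hσ : inner ℝ n V = σ := by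
    have h6 := congrArg (fun z => inner ℝ n z) hu'q
    have h7 : ∀ a, m a * u' a * (S * u a) = S * (m a * u a * u' a) := fun a => by ring
    simp only [inner_sum, inner_smul_right, h.inner_centered, inner_sub_right, inner_add_right,
      h.inner_self, h1, ← hSdef, h7, ← Finset.mul_sum, h2] at h6
    linarith
  set b := transverseVelocity m n u v with hb
  have hbV : b = V - σ • n := by rw [hb, transverseVelocity, ← hV, hσ]
  have hnb : inner ℝ n b = 0 := by
    rw [hbV, inner_sub_right, inner_smul_right, hσ, h.inner_self]
    ring
  -- The place where zero angular momentum enters: it trades n·vₐ for n·xₐ = S uₐ and so produces a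
  -- factor S.
  have hJn : ∑ a, (m a * inner ℝ n (centered m v a)) • centered m q a = S • V := by
    rw [sum_smul_centered_of_angularMomentum_eq_zero hJ, ← hVc, Finset.smul_sum]
    refine Finset.sum_congr rfl fun a _ => ?_
    rw [h.inner_centered, smul_smul]
    congr 1
    ring
  have hU1 := isUnit_gapMap hd hm h hS le_rfl
  have hU0 := isUnit_gapMap hd hm h hS (sq_nonneg (signedDistance m q))
  rw [← hSdef] at hU1
  set ξ := Ring.inverse (gapMap m q n (S ^ 2)) b with hξ
  set ζ := Ring.inverse (gapMap m q n 0) b with hζ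
  have hKξ : gapMap m q n (S ^ 2) ξ = b := gapMap_inverse_apply hU1 b
  have hKζ : gapMap m q n 0 ζ = b := gapMap_inverse_apply hU0 b
  -- Eliminating u' between the two differentiated singular vector equations leaves a linear
  -- equation for n'.
  have hKn' : gapMap m q n (S ^ 2) n' = (-2 * S) • b := by
    have h6 : ∀ a, (m a * inner ℝ n' (centered m q a)) • centered m q a =
        σ • (m a * u a) • centered m q a + S • (m a * u' a) • centered m q a -
          (m a * inner ℝ n (centered m v a)) • centered m q a := fun a => by
      rw [eq_sub_of_add_eq (h4 a)]
      module
    rw [gapMap_apply, h1]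
    simp only [h6, Finset.sum_sub_distrib, Finset.sum_add_distrib, ← Finset.smul_sum]
    rw [huq, hu'q, hJn, hbV]
    module
  have hn' : n' = (-2 * S) • ξ := by
    rw [hξ, ← map_smul, ← hKn', ← mul_apply_eq_comp, Ring.inverse_mul_cancel _ hU1,
      one_apply_eq_self]
  have hnζ : inner ℝ n ζ = 0 := by
    have h6 := h.inner_gapMap_zero ζ
    rw [hKζ, hnb] at h6
    rcases mul_eq_zero.mp h6.symm with h7 | h7
    · nlinarith [sq_nonneg (signedDistance m q)]
    · exact h7
  have hAζ : ∑ a, (m a * inner ℝ ζ (centered m q a)) • centered m q a = b := by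
    rw [← hKζ, gapMap_apply, hnζ]
    module
  -- The normal velocities n·vₐ are determined completely: the difference is orthogonal to
  -- constants, to u and to the coordinates of q, so `eq_zero_of_sum` applies. Hence the part
  -- transverse to u also carries a factor S.
  have hb' : (fun a => inner ℝ n (centered m v a) - σ * u a - S * inner ℝ ζ (centered m q a)) =
      0 := by
    have h6 : ∑ a, m a * (inner ℝ n (centered m v a) - σ * u a -
        S * inner ℝ ζ (centered m q a)) = 0 := by
      simp only [mul_sub, Finset.sum_sub_distrib, mul_left_comm (m _), ← Finset.mul_sum,
        sum_mul_inner_centered hm, h.sum_eq]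
      ring
    refine h.eq_zero_of_sum hm hS h6 ?_ ?_
    · have h7 : ∀ a, m a * (inner ℝ n (centered m v a) - σ * u a -
          S * inner ℝ ζ (centered m q a)) * u a = m a * u a * inner ℝ n (centered m v a) -
          σ * (m a * u a ^ 2) - S * (m a * u a * inner ℝ ζ (centered m q a)) := fun a => by ring
      have h8 := congrArg (fun z => inner ℝ n z) hVc
      have h9 := congrArg (fun z => inner ℝ ζ z) huq
      simp only [inner_sum, inner_smul_right, hσ, real_inner_comm n ζ, hnζ] at h8 h9
      simp only [h7, Finset.sum_sub_distrib, ← Finset.mul_sum, h8, h9, h.sum_sq]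
      ring
    · have h7 : ∀ a, (m a * (inner ℝ n (centered m v a) - σ * u a -
          S * inner ℝ ζ (centered m q a))) • centered m q a =
          (m a * inner ℝ n (centered m v a)) • centered m q a -
          σ • (m a * u a) • centered m q a -
          S • (m a * inner ℝ ζ (centered m q a)) • centered m q a := fun a => by module
      rw [← sum_smul_centered_of_sum_eq_zero (m := m) q h6]
      simp only [h7, Finset.sum_sub_distrib, ← Finset.smul_sum]
      rw [hJn, huq, hAζ, hbV]
      module
  have hlast : ∑ a, m a * u' a * inner ℝ n (v a) = S * inner ℝ ζ (S • n' - b) := by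
    have h6 : ∀ a, m a * u' a * inner ℝ n (v a) = inner ℝ n (centerOfMass m v) * (m a * u' a) +
        σ * (m a * u a * u' a) + S * (m a * u' a * inner ℝ ζ (centered m q a)) := fun a => by
      have h7 := congrFun hb' a
      simp only [Pi.zero_apply, sub_eq_zero] at h7
      have h8 : inner ℝ n (v a) =
          inner ℝ n (centerOfMass m v) + inner ℝ n (centered m v a) := by
        rw [centered, inner_sub_right]
        ring
      rw [h8, sub_eq_iff_eq_add.mp h7]
      ring
    have h9 := congrArg (fun z => inner ℝ ζ z) hu'q
    simp only [inner_sum, inner_smul_right] at h9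
    simp only [h6, Finset.sum_add_distrib, ← Finset.mul_sum, h2, h3, h9]
    have h10 : σ • n + S • n' - V = S • n' - b := by
      rw [hbV]
      module
    rw [h10]
    ring
  -- The resolvent identity for K₀ and K_{S²} = K₀ - S²; it absorbs the cubic term in S left by
  -- substituting n' = -2S ξ.
  have hξζ : S ^ 2 * inner ℝ ζ ξ = inner ℝ b ξ - inner ℝ b ζ := by
    have h6 := inner_gapMap_comm (m := m) (q := q) (n := n) (S ^ 2) ζ ξ
    rw [hKξ, gapMap_zero_apply, hKζ, inner_sub_right, inner_smul_right, real_inner_comm b ξ,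
      real_inner_comm ζ ξ] at h6
    linarith
  have hn'V : inner ℝ n' V = inner ℝ n' b := by
    rw [hbV, inner_sub_right, inner_smul_right, real_inner_comm n n', h1]
    ring
  rw [hn'V, hlast, hn', hessianCoefficient, ← hSdef, ← hb, ← hξ, ← hζ]
  simp only [inner_sub_right, inner_smul_right, inner_smul_left, conj_trivial]
  rw [real_inner_comm b ξ, real_inner_comm b ζ]
  linear_combination (-2 * S) * hξζ

/-- The singular pair identities hold near q for the differentiable choice of pair. Differentiating
each along q + t v supplies the hypotheses of `hessian_eq`, and differentiating the formula for dS
supplies its left side. -/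
theorem fderiv_fderiv_apply (hd : 1 ≤ d) (hm : ∀ a, 0 < m a) (h : IsSingularPair m q n u)
    (hS : ContDiffAt ℝ 2 (signedDistance m) q) {v : Config d}
    (hJ : angularMomentum m q v = 0) :
    fderiv ℝ (fderiv ℝ (signedDistance m)) q v v =
      -signedDistance m q * hessianCoefficient m q n u v := by
  obtain ⟨ν, μ, hν, hμ, hνq, hμq, hev⟩ := h.exists_differentiableAt hd hm hS
  have hS1 : DifferentiableAt ℝ (signedDistance m) q := hS.differentiableAt two_ne_zero
  have hdS : DifferentiableAt ℝ (fderiv ℝ (signedDistance m)) q :=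
    (hS.fderiv_right (m := 1) (by norm_num)).differentiableAt one_ne_zero
  have hq0 : q + (0 : ℝ) • v = q := by simp
  have hline := hasDerivAt_line q v
  have hN : HasDerivAt (fun t : ℝ => ν (q + t • v)) (fderiv ℝ ν q v) 0 :=
    HasFDerivAt.comp_hasDerivAt (0 : ℝ) (by rw [hq0]; exact hν.hasFDerivAt) hline
  have hM : ∀ a, HasDerivAt (fun t : ℝ => μ (q + t • v) a) (fderiv ℝ μ q v a) 0 :=
    hasDerivAt_pi.mp
      (HasFDerivAt.comp_hasDerivAt (0 : ℝ) (by rw [hq0]; exact hμ.hasFDerivAt) hline)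
  have hD : HasDerivAt (fun t : ℝ => fderiv ℝ (signedDistance m) (q + t • v) v)
      (fderiv ℝ (fderiv ℝ (signedDistance m)) q v v) 0 := by
    have h1 : HasDerivAt (fun t : ℝ => fderiv ℝ (signedDistance m) (q + t • v))
        (fderiv ℝ (fderiv ℝ (signedDistance m)) q v) 0 :=
      HasFDerivAt.comp_hasDerivAt (0 : ℝ) (by rw [hq0]; exact hdS.hasFDerivAt) hline
    simpa using h1.clm_apply (hasDerivAt_const (0 : ℝ) v)
  have hs := hasDerivAt_signedDistance_line hS1 v
  have hqa : ∀ a, HasDerivAt (fun t : ℝ => (q + t • v) a) (v a) 0 := hasDerivAt_pi.mp hline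
  have hca : ∀ a, HasDerivAt (fun t : ℝ => centered m (q + t • v) a) (centered m v a) 0 := by
    intro a
    simp only [centered_add_smul]
    simpa using ((hasDerivAt_id (0 : ℝ)).smul_const (centered m v a)).const_add (centered m q a)
  have hevt : ∀ᶠ t in 𝓝 (0 : ℝ), IsSingularPair m (q + t • v) (ν (q + t • v)) (μ (q + t • v)) := by
    have := hline.continuousAt.tendsto
    rw [hq0] at this
    exact this.eventually hev
  have hpa : ∀ a, HasDerivAt (fun t : ℝ => m a * μ (q + t • v) a)
      (m a * fderiv ℝ μ q v a) 0 := fun a => (hM a).const_mul _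
  rw [hD.unique ((HasDerivAt.fun_sum fun a _ =>
      (hpa a).mul (hN.inner ℝ (hasDerivAt_const (0 : ℝ) (v a)))).congr_of_eventuallyEq
    (hevt.mono fun t ht => ht.fderiv_apply v))]
  have e1 := (hN.norm_sq).unique ((hasDerivAt_const (0 : ℝ) (1 : ℝ)).congr_of_eventuallyEq
    (hevt.mono fun t ht => by simp [ht.norm_eq]))
  have e2 := (HasDerivAt.fun_sum (u := Finset.univ) fun a _ =>
    ((hM a).fun_pow 2).const_mul (m a)).unique
    ((hasDerivAt_const (0 : ℝ) (1 : ℝ)).congr_of_eventuallyEq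
      (hevt.mono fun t ht => ht.sum_sq))
  have e3 := (HasDerivAt.fun_sum (u := Finset.univ) fun a _ => hpa a).unique
    ((hasDerivAt_const (0 : ℝ) (0 : ℝ)).congr_of_eventuallyEq (hevt.mono fun t ht => ht.sum_eq))
  have e4 := fun a => (hN.inner ℝ (hca a)).unique
    ((hs.mul (hM a)).congr_of_eventuallyEq (hevt.mono fun t ht => ht.inner_centered a))
  have e5 := (HasDerivAt.fun_sum (u := Finset.univ) fun a _ => (hpa a).smul (hqa a)).unique
    ((hs.smul hN).congr_of_eventuallyEq (hevt.mono fun t ht => ht.sum_smul))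
  simp only [hq0, hνq, hμq] at e1 e2 e3 e4 e5 ⊢
  rw [← h.hessian_eq hd hm hS1 hJ (n' := fderiv ℝ ν q v) (u' := fderiv ℝ μ q v)
    (σ := fderiv ℝ (signedDistance m) q v) (by linarith) ?_ e3 (fun a => ?_) ?_]
  · simp only [inner_sum, inner_smul_right, inner_zero_right, zero_add, Finset.sum_add_distrib]
    rw [add_comm]
  · have : ∀ a, m a * (((2 : ℕ) : ℝ) * u a ^ (2 - 1) * fderiv ℝ μ q v a) =
        2 * (m a * u a * fderiv ℝ μ q v a) := fun a => by
      norm_num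
      ring
    simp only [this, ← Finset.mul_sum] at e2
    linarith
  · rw [Finset.sum_add_distrib] at e5
    rw [add_comm, e5, add_comm]
  · rw [← e4 a, add_comm]

end IsSingularPair

end

/-! ### The restoring force and its lower bound -/

section

variable {d : ℕ} {m : Fin (d + 1) → ℝ} {q : Config d} {n : EuclideanSpace ℝ (Fin d)}
  {u : Fin (d + 1) → ℝ} {G : ℝ} {f : Fin (d + 1) → Fin (d + 1) → ℝ → ℝ}

/-- Lagrange's identity: the pair sum equals M ∑ mₐ uₐ² - (∑ mₐ uₐ)². This is the source of the
factor M in the lower bound. -/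
theorem sum_Ioi_mul_sq_sub (hu : ∑ a, m a * u a = 0) (hu2 : ∑ a, m a * u a ^ 2 = 1) :
    ∑ a, ∑ b ∈ Finset.Ioi a, m a * m b * (u a - u b) ^ 2 = totalMass m := by
  have h1 := Finset.sum_sum_Ioi_add_eq_sum_sum_off_diag
    fun a b => m a * m b * (u a - u b) ^ 2
  have h2 : ∀ a b, m b * m a * (u b - u a) ^ 2 + m a * m b * (u a - u b) ^ 2 =
      2 * (m a * m b * (u a - u b) ^ 2) := fun a b => by ring
  have h3 : ∀ a, ∑ b ∈ {a}ᶜ, m b * m a * (u b - u a) ^ 2 =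
      m a * 1 + m a * u a ^ 2 * totalMass m := by
    intro a
    have h4 := Finset.sum_compl_add_sum {a} fun b => m b * m a * (u b - u a) ^ 2
    rw [Finset.sum_singleton, sub_self, zero_pow two_ne_zero, mul_zero, add_zero] at h4
    rw [h4, ← hu2, totalMass]
    have h5 : ∀ b, m b * m a * (u b - u a) ^ 2 =
        m a * (m b * u b ^ 2) + m a * u a ^ 2 * m b - 2 * m a * u a * (m b * u b) :=
      fun b => by ring
    simp only [h5, Finset.sum_sub_distrib, Finset.sum_add_distrib, ← Finset.mul_sum, hu]
    ring
  simp only [h2, h3, ← Finset.mul_sum, Finset.sum_add_distrib, mul_one] at h1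
  rw [← Finset.sum_mul, hu2, show ∑ a, m a = totalMass m from rfl] at h1
  linarith

namespace IsAttractive

variable {φ : ℝ → ℝ}

theorem hasDerivAt (hφ : IsAttractive φ) {r : ℝ} (hr : 0 < r) : HasDerivAt φ (deriv φ r) r :=
  (differentiableAt_of_deriv_ne_zero (hφ.deriv_pos r hr).ne').hasDerivAt

theorem differentiableAt_deriv (hφ : IsAttractive φ) {r : ℝ} (hr : 0 < r) :
    DifferentiableAt ℝ (deriv φ) r :=
  differentiableAt_of_deriv_ne_zero (hφ.deriv_deriv_neg r hr).ne

theorem deriv_div_le (hφ : IsAttractive φ) {r c : ℝ} (hr : 0 < r) (hrc : r ≤ c) :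
    deriv φ c / c ≤ deriv φ r / r := by
  have h1 : AntitoneOn (deriv φ) (Set.Ioi 0) := by
    refine antitoneOn_of_deriv_nonpos (convex_Ioi 0)
      (fun x hx => (hφ.differentiableAt_deriv hx).continuousAt.continuousWithinAt) ?_ ?_ <;>
    rw [interior_Ioi]
    · exact fun x hx => (hφ.differentiableAt_deriv hx).differentiableWithinAt
    · exact fun x hx => (hφ.deriv_deriv_neg x hx).le
  have hc := hr.trans_le hrc
  exact div_le_div₀ (hφ.deriv_pos r hr).le (h1 hr hc hrc) hr hrc

end IsAttractive

/-- The factor in `dS(∇V) = S · pairStrength`. -/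
def pairStrength (G : ℝ) (m : Fin (d + 1) → ℝ) (f : Fin (d + 1) → Fin (d + 1) → ℝ → ℝ)
    (q : Config d) (u : Fin (d + 1) → ℝ) : ℝ :=
  G * ∑ a, ∑ b ∈ Finset.Ioi a,
    m a * m b * (deriv (f a b) (dist (q a) (q b)) / dist (q a) (q b)) * (u a - u b) ^ 2

theorem pairStrength_neg : pairStrength G m f q (-u) = pairStrength G m f q u := by
  have : ∀ a b, ((-u) a - (-u) b) ^ 2 = (u a - u b) ^ 2 := fun a b => by
    simp only [Pi.neg_apply]
    ring
  simp only [pairStrength, this]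

theorem CollisionFree.dist_pos (hq : CollisionFree q) {a b : Fin (d + 1)} (hab : a < b) :
    0 < dist (q a) (q b) :=
  _root_.dist_pos.mpr (hq a b hab.ne)

/-- A uniform lower bound for the pair forces bounds the restoring force. -/
theorem IsSingularPair.le_pairStrength (hm : ∀ a, 0 < m a) (hG : 0 < G)
    (h : IsSingularPair m q n u) {δ : ℝ}
    (hδ : ∀ a b, a < b → δ ≤ deriv (f a b) (dist (q a) (q b)) / dist (q a) (q b)) :
    G * totalMass m * δ ≤ pairStrength G m f q u := by
  rw [pairStrength, mul_assoc, ← sum_Ioi_mul_sq_sub h.sum_eq h.sum_sq]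
  simp only [Finset.sum_mul]
  refine mul_le_mul_of_nonneg_left (Finset.sum_le_sum fun a _ => Finset.sum_le_sum fun b hb => ?_)
    hG.le
  have h1 : 0 ≤ m a * m b * (u a - u b) ^ 2 :=
    mul_nonneg (mul_pos (hm a) (hm b)).le (sq_nonneg _)
  linarith [mul_le_mul_of_nonneg_left (hδ a b (Finset.mem_Ioi.mp hb)) h1]

theorem IsSingularPair.pairStrength_pos (hm : ∀ a, 0 < m a) (hG : 0 < G)
    (hf : ∀ a b, a < b → IsAttractive (f a b)) (hq : CollisionFree q)
    (h : IsSingularPair m q n u) : 0 < pairStrength G m f q u := by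
  have h1 : ∃ δ : ℝ, 0 < δ ∧ ∀ a b, a < b →
      δ ≤ deriv (f a b) (dist (q a) (q b)) / dist (q a) (q b) := by
    -- The default value 1 off the ordered pairs keeps the minimum over the full finite product
    -- positive.
    let F : Fin (d + 1) × Fin (d + 1) → ℝ := fun p =>
      if p.1 < p.2 then deriv (f p.1 p.2) (dist (q p.1) (q p.2)) / dist (q p.1) (q p.2) else 1
    obtain ⟨p, hp⟩ := Finite.exists_min F
    refine ⟨F p, ?_, fun a b hab => ?_⟩
    · simp only [F]
      split_ifs with hlt
      · exact div_pos ((hf _ _ hlt).deriv_pos _ (hq.dist_pos hlt)) (hq.dist_pos hlt)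
      · exact one_pos
    · simpa [F, hab] using hp (a, b)
  obtain ⟨δ, hδ, hle⟩ := h1
  exact (mul_pos (mul_pos hG (totalMass_pos hm)) hδ).trans_le (h.le_pairStrength hm hG hle)

theorem hasDerivAt_norm_of_ne_zero {E : Type*} [NormedAddCommGroup E] [InnerProductSpace ℝ E]
    {x : ℝ → E} {x' : E} {t : ℝ} (h : HasDerivAt x x' t) (hx : x t ≠ 0) :
    HasDerivAt (fun s => ‖x s‖) (inner ℝ (x t) x' / ‖x t‖) t := by
  have h1 := h.norm_sq.sqrt (pow_ne_zero 2 (norm_ne_zero_iff.mpr hx))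
  simp only [Real.sqrt_sq (norm_nonneg _)] at h1
  rwa [mul_div_mul_left _ _ two_ne_zero] at h1

/-- Since n·(qₐ - q_b) = S (uₐ - u_b), moving along u ⊗ n changes each r_ab at rate S (uₐ - u_b)² /
r_ab, so every pair contributes the same factor S. -/
theorem IsSingularPair.hasDerivAt_potential (hf : ∀ a b, a < b → IsAttractive (f a b))
    (hq : CollisionFree q) (h : IsSingularPair m q n u) :
    HasDerivAt (fun t : ℝ => potential G m f (q + t • (fun a => u a • n : Config d)))
      (signedDistance m q * pairStrength G m f q u) 0 := by
  have hdist : ∀ a b, a < b → HasDerivAt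
      (fun t : ℝ => dist ((q + t • (fun a => u a • n : Config d)) a)
        ((q + t • (fun a => u a • n : Config d)) b))
      (signedDistance m q * (u a - u b) ^ 2 / dist (q a) (q b)) 0 := by
    intro a b hab
    have h1 := hasDerivAt_pi.mp (hasDerivAt_line q (fun a => u a • n : Config d))
    have h2 := (h1 a).sub (h1 b)
    have h3 := hasDerivAt_norm_of_ne_zero h2 (by simpa [sub_eq_zero] using hq a b hab.ne)
    have h4 : inner ℝ (q a - q b) (u a • n - u b • n) = signedDistance m q * (u a - u b) ^ 2 := by
      rw [← sub_smul, inner_smul_right, real_inner_comm, ← centered_sub_centered (m := m),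
        inner_sub_right, h.inner_centered, h.inner_centered]
      ring
    simp only [dist_eq_norm]
    simpa [h4] using h3
  have hpair : ∀ a b, a < b → HasDerivAt
      (fun t : ℝ => m a * m b * f a b (dist ((q + t • (fun a => u a • n : Config d)) a)
        ((q + t • (fun a => u a • n : Config d)) b)))
      (signedDistance m q * (m a * m b *
        (deriv (f a b) (dist (q a) (q b)) / dist (q a) (q b)) * (u a - u b) ^ 2)) 0 := by
    intro a b hab
    have h1 : HasDerivAt (f a b) (deriv (f a b) (dist (q a) (q b)))
        (dist ((q + (0 : ℝ) • (fun a => u a • n : Config d)) a)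
          ((q + (0 : ℝ) • (fun a => u a • n : Config d)) b)) := by
      simpa using (hf a b hab).hasDerivAt (hq.dist_pos hab)
    refine ((h1.comp (0 : ℝ) (hdist a b hab)).const_mul (m a * m b)).congr_deriv ?_
    ring
  have := (HasDerivAt.fun_sum (u := Finset.univ) fun a _ => HasDerivAt.fun_sum
    (u := Finset.Ioi a) fun b hb => hpair a b (Finset.mem_Ioi.mp hb)).const_mul G
  refine this.congr_deriv ?_
  rw [pairStrength]
  simp only [← Finset.mul_sum]
  ring

/-- The mass gradient of S is u ⊗ n, so by symmetry of the inner product dS(∇V) = dV(u ⊗ n). -/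
theorem IsSingularPair.fderiv_of_isMassGradientAt (hf : ∀ a b, a < b → IsAttractive (f a b))
    (hq : CollisionFree q) (h : IsSingularPair m q n u) {w : Config d}
    (hw : IsMassGradientAt m (potential G m f) q w) :
    fderiv ℝ (signedDistance m) q w = signedDistance m q * pairStrength G m f q u := by
  have h0 : HasFDerivAt (potential G m f) (fderiv ℝ (potential G m f) q)
      (q + (0 : ℝ) • (fun a => u a • n : Config d)) := by
    simpa using hw.1.hasFDerivAt
  have h1 := h0.comp_hasDerivAt (0 : ℝ) (hasDerivAt_line q (fun a => u a • n : Config d))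
  rw [← h1.unique (h.hasDerivAt_potential hf hq), hw.2, massInner, h.fderiv_apply]
  refine Finset.sum_congr rfl fun a _ => ?_
  rw [inner_smul_right, real_inner_comm]
  ring

/-! ### The oscillator coefficient: continuity, equation and lower bound -/

open Classical in
/-- The coefficient `g` of the oscillator equation `S'' = -S g`. -/
def oscillatorCoefficient (G : ℝ) (m : Fin (d + 1) → ℝ)
    (f : Fin (d + 1) → Fin (d + 1) → ℝ → ℝ) (s : Config d × Config d) : ℝ :=
  if h : ∃ z : EuclideanSpace ℝ (Fin d) × (Fin (d + 1) → ℝ), IsSingularPair m s.1 z.1 z.2 then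
    pairStrength G m f s.1 h.choose.2 + hessianCoefficient m s.1 h.choose.1 h.choose.2 s.2
  else 0

/-- Any pair may replace the chosen one: pairs differ by a common sign, under which both summands
are even. Continuity can therefore be checked with a local differentiable choice. -/
theorem IsSingularPair.oscillatorCoefficient_eq (hm : ∀ a, 0 < m a) (h : IsSingularPair m q n u)
    (v : Config d) : oscillatorCoefficient G m f (q, v) =
      pairStrength G m f q u + hessianCoefficient m q n u v := by
  have hex : ∃ z : EuclideanSpace ℝ (Fin d) × (Fin (d + 1) → ℝ),
      IsSingularPair m (q, v).1 z.1 z.2 := ⟨(n, u), h⟩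
  rw [oscillatorCoefficient, dif_pos hex]
  rcases h.eq_or_eq_neg hm hex.choose_spec with ⟨h1, h2⟩ | ⟨h1, h2⟩
  · rw [h1, h2]
  · rw [h1, h2, pairStrength_neg, hessianCoefficient_neg]

theorem SmoothAt.contDiffAt_two (h : SmoothAt m q) : ContDiffAt ℝ 2 (signedDistance m) q :=
  contDiffAt_infty.mp h 2

theorem SmoothAt.exists_isSingularPair (hd : 1 ≤ d) (hm : ∀ a, 0 < m a) (h : SmoothAt m q) :
    ∃ n u, IsSingularPair m q n u :=
  NBody.exists_isSingularPair hd hm (h.contDiffAt_two.of_le (by norm_num))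

theorem continuousAt_pairStrength (hf : ∀ a b, a < b → IsAttractive (f a b))
    {s : Config d × Config d} (hq : CollisionFree s.1)
    {μ : Config d → Fin (d + 1) → ℝ} (hμ : ContinuousAt μ s.1) :
    ContinuousAt (fun s : Config d × Config d => pairStrength G m f s.1 (μ s.1)) s := by
  have hμ' : ∀ a, ContinuousAt (fun s : Config d × Config d => μ s.1 a) s := fun a =>
    (continuousAt_pi.mp hμ a).comp (f := fun s : Config d × Config d => s.1) continuousAt_fst
  have hr : ∀ a b, ContinuousAt (fun s : Config d × Config d => dist (s.1 a) (s.1 b)) s :=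
    fun a b => by fun_prop
  refine continuousAt_const.mul (tendsto_finsetSum _ fun a _ => tendsto_finsetSum _ fun b hb => ?_)
  have hab := Finset.mem_Ioi.mp hb
  have h1 : ContinuousAt
      (fun s : Config d × Config d => deriv (f a b) (dist (s.1 a) (s.1 b))) s :=
    ContinuousAt.comp (f := fun s : Config d × Config d => dist (s.1 a) (s.1 b))
      ((hf a b hab).differentiableAt_deriv (hq.dist_pos hab)).continuousAt (hr a b)
  exact (continuousAt_const.mul (h1.div (hr a b) (hq.dist_pos hab).ne')).mul
    (((hμ' a).sub (hμ' b)).pow 2)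

theorem continuousAt_hessianCoefficient (hd : 1 ≤ d) (hm : ∀ a, 0 < m a)
    {s : Config d × Config d} (hS : ContDiffAt ℝ 1 (signedDistance m) s.1)
    {ν : Config d → EuclideanSpace ℝ (Fin d)} {μ : Config d → Fin (d + 1) → ℝ}
    (hν : ContinuousAt ν s.1) (hμ : ContinuousAt μ s.1)
    (h : IsSingularPair m s.1 (ν s.1) (μ s.1)) :
    ContinuousAt
      (fun s : Config d × Config d => hessianCoefficient m s.1 (ν s.1) (μ s.1) s.2) s := by
  have hν' : ContinuousAt (fun s : Config d × Config d => ν s.1) s :=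
    hν.comp (f := fun s : Config d × Config d => s.1) continuousAt_fst
  have hμ' : ∀ a, ContinuousAt (fun s : Config d × Config d => μ s.1 a) s := fun a =>
    (continuousAt_pi.mp hμ a).comp (f := fun s : Config d × Config d => s.1) continuousAt_fst
  have hS' : ContinuousAt (fun s : Config d × Config d => signedDistance m s.1 ^ 2) s :=
    (hS.continuousAt.comp (f := fun s : Config d × Config d => s.1) continuousAt_fst).pow 2
  have hV : ContinuousAt
      (fun s : Config d × Config d => ∑ a, (m a * μ s.1 a) • s.2 a) s :=
    tendsto_finsetSum _ fun a _ => (continuousAt_const.mul (hμ' a)).smul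
      (by fun_prop : Continuous fun s : Config d × Config d => s.2 a).continuousAt
  have hb : ContinuousAt
      (fun s : Config d × Config d => transverseVelocity m (ν s.1) (μ s.1) s.2) s :=
    hV.sub ((ContinuousAt.inner (𝕜 := ℝ) hν' hV).smul hν')
  have hrank : Continuous fun p : EuclideanSpace ℝ (Fin d) × EuclideanSpace ℝ (Fin d) =>
      InnerProductSpace.rankOne ℝ p.1 p.2 :=
    (ContinuousLinearMap.smulRightL ℝ (EuclideanSpace ℝ (Fin d))
      (EuclideanSpace ℝ (Fin d))).continuous₂.comp
      (((innerSL ℝ).continuous.comp continuous_snd).prodMk continuous_fst)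
  have hgap : ∀ σ : Config d × Config d → ℝ, ContinuousAt σ s →
      ContinuousAt (fun s : Config d × Config d => gapMap m s.1 (ν s.1) (σ s)) s := by
    intro σ hσ
    refine (ContinuousAt.add (tendsto_finsetSum _ fun a _ => ?_) ?_).sub
      (hσ.smul continuousAt_const)
    · have hc := (continuous_centered m a).comp
        (continuous_fst : Continuous fun s : Config d × Config d => s.1)
      exact ((hrank.comp (hc.prodMk hc)).const_smul (m a)).continuousAt
    · exact hrank.continuousAt.comp (f := fun s : Config d × Config d => (ν s.1, ν s.1))
        (hν'.prodMk hν')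
  have hinv : ∀ σ : Config d × Config d → ℝ, ContinuousAt σ s →
      σ s ≤ signedDistance m s.1 ^ 2 →
      ContinuousAt (fun s : Config d × Config d => Ring.inverse (gapMap m s.1 (ν s.1) (σ s))) s := by
    intro σ hσ hle
    obtain ⟨x, hx⟩ := isUnit_gapMap hd hm h (hS.differentiableAt one_ne_zero) hle
    have h1 : ContinuousAt Ring.inverse (gapMap m s.1 (ν s.1) (σ s)) := by
      rw [← hx]
      exact NormedRing.inverse_continuousAt x
    exact h1.comp (f := fun s : Config d × Config d => gapMap m s.1 (ν s.1) (σ s)) (hgap σ hσ)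
  exact (continuousAt_const.mul (ContinuousAt.inner (𝕜 := ℝ) hb ((hinv _ hS' le_rfl).clm_apply hb))).sub
    (ContinuousAt.inner (𝕜 := ℝ) hb ((hinv _ continuousAt_const (sq_nonneg _)).clm_apply hb))

theorem continuousOn_oscillatorCoefficient (hd : 1 ≤ d) (hm : ∀ a, 0 < m a)
    (hf : ∀ a b, a < b → IsAttractive (f a b)) :
    ContinuousOn (oscillatorCoefficient G m f) (regularStates m) := by
  rintro s ⟨hq, hS, -⟩
  obtain ⟨n, u, h⟩ := hS.exists_isSingularPair hd hm
  obtain ⟨ν, μ, hν, hμ, hνq, hμq, hev⟩ := h.exists_differentiableAt hd hm hS.contDiffAt_two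
  have h1 := (continuousAt_pairStrength (G := G) (m := m) hf hq hμ.continuousAt).add
    (continuousAt_hessianCoefficient hd hm (hS.contDiffAt_two.of_le (by norm_num))
      hν.continuousAt hμ.continuousAt (by rwa [hνq, hμq]))
  refine (h1.congr ?_).continuousWithinAt
  filter_upwards [continuousAt_fst.eventually hev] with y hy
  exact (hy.oscillatorCoefficient_eq hm y.2).symm

theorem isOscillatorCoefficient_oscillatorCoefficient (hd : 1 ≤ d) (hm : ∀ a, 0 < m a)
    (hG : 0 < G) (hf : ∀ a b, a < b → IsAttractive (f a b)) :
    IsOscillatorCoefficient G m f (oscillatorCoefficient G m f) where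
  pos := by
    rintro ⟨q, v⟩ ⟨hq, hS, -⟩
    obtain ⟨n, u, h⟩ := hS.exists_isSingularPair hd hm
    rw [h.oscillatorCoefficient_eq hm]
    exact add_pos_of_pos_of_nonneg (h.pairStrength_pos hm hG hf hq)
      (hessianCoefficient_nonneg hd hm h (hS.contDiffAt_two.differentiableAt two_ne_zero) v)
  continuousOn := continuousOn_oscillatorCoefficient hd hm hf
  equation := by
    intro I _ q v hsol hJ hS
    refine ⟨fun t => fderiv ℝ (signedDistance m) (q t) (v t), fun t ht => ⟨?_, ?_⟩⟩
    · exact ((hS t ht).contDiffAt_two.differentiableAt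
        two_ne_zero).hasFDerivAt.comp_hasDerivWithinAt t (hsol.velocity t ht)
    · obtain ⟨w, hw, hv⟩ := hsol.newton t ht
      obtain ⟨n, u, h⟩ := (hS t ht).exists_isSingularPair hd hm
      have hdS : DifferentiableAt ℝ (fderiv ℝ (signedDistance m)) (q t) :=
        ((hS t ht).contDiffAt_two.fderiv_right (m := 1) (by norm_num)).differentiableAt one_ne_zero
      refine ((hdS.hasFDerivAt.comp_hasDerivWithinAt t (hsol.velocity t ht)).clm_apply
        hv).congr_deriv ?_
      -- The chain rule gives D²S(v, v) + dS(-w), with w the mass gradient of V; each term is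
      -- replaced by its multiple of S.
      rw [h.fderiv_fderiv_apply hd hm (hS t ht).contDiffAt_two (hJ t ht), map_neg,
        Function.comp_apply, h.fderiv_of_isMassGradientAt hf (hsol.collisionFree t ht) hw,
        h.oscillatorCoefficient_eq hm]
      ring

theorem delta_le (f : Fin (d + 1) → Fin (d + 1) → ℝ → ℝ) (c : ℝ) {a b : Fin (d + 1)}
    (hab : a < b) : delta f c ≤ deriv (f a b) c / c :=
  ciInf_le (Set.finite_range _).bddBelow
    (⟨(a, b), hab⟩ : {p : Fin (d + 1) × Fin (d + 1) // p.1 < p.2})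

theorem le_oscillatorCoefficient (hd : 1 ≤ d) (hm : ∀ a, 0 < m a) (hG : 0 < G)
    (hf : ∀ a b, a < b → IsAttractive (f a b)) {c : ℝ} {q v : Config d}
    (hqv : (q, v) ∈ regularStates m) (hc : ∀ a b, dist (q a) (q b) ≤ c) :
    G * totalMass m * delta f c ≤ oscillatorCoefficient G m f (q, v) := by
  obtain ⟨hq, hS, -⟩ := hqv
  obtain ⟨n, u, h⟩ := SmoothAt.exists_isSingularPair hd hm hS
  rw [h.oscillatorCoefficient_eq hm]
  have h1 := hessianCoefficient_nonneg hd hm h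
    ((SmoothAt.contDiffAt_two hS).differentiableAt two_ne_zero) v
  have h2 := h.le_pairStrength hm hG (f := f) (δ := delta f c) fun a b hab =>
    (delta_le f c hab).trans ((hf a b hab).deriv_div_le (CollisionFree.dist_pos hq hab) (hc a b))
  linarith

/-! ### The Newtonian potential -/

theorem deriv_newtonian {r : ℝ} (hr : r ≠ 0) (a b : Fin (d + 1)) :
    deriv (newtonian d a b) r = 1 / r ^ 2 := by
  have h : HasDerivAt (fun r : ℝ => -1 / r) (1 / r ^ 2) r :=
    ((hasDerivAt_const r (-1 : ℝ)).fun_div (hasDerivAt_id' r) hr).congr_deriv (by ring)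
  exact h.deriv

theorem isAttractive_newtonian (a b : Fin (d + 1)) : IsAttractive (newtonian d a b) where
  deriv_pos r hr := by
    rw [deriv_newtonian hr.ne']
    positivity
  deriv_deriv_neg r hr := by
    have h1 : deriv (newtonian d a b) =ᶠ[𝓝 r] fun r => 1 / r ^ 2 := by
      filter_upwards [eventually_ne_nhds hr.ne'] with x hx using deriv_newtonian hx a b
    have h2 : HasDerivAt (fun r : ℝ => 1 / r ^ 2) (-2 / r ^ 3) r := by
      refine ((hasDerivAt_const r (1 : ℝ)).fun_div (hasDerivAt_pow 2 r)
        (pow_ne_zero 2 hr.ne')).congr_deriv ?_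
      field_simp
      norm_num [mul_comm]
    rw [h1.deriv_eq, h2.deriv]
    exact div_neg_of_neg_of_pos (by norm_num) (by positivity)
  tendsto := by
    refine (tendsto_inv_atTop_zero.comp
      (Filter.tendsto_pow_atTop (α := ℝ) three_ne_zero)).congr' ?_
    filter_upwards [Filter.eventually_ne_atTop 0] with r hr
    rw [deriv_newtonian hr, Function.comp_apply]
    field_simp

theorem delta_newtonian (hd : 1 ≤ d) {c : ℝ} (hc : 0 < c) :
    delta (newtonian d) c = 1 / c ^ 3 := by
  have : Nonempty {p : Fin (d + 1) × Fin (d + 1) // p.1 < p.2} :=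
    ⟨⟨(0, Fin.last d), by simpa [Fin.lt_def] using Nat.pos_of_ne_zero (by omega)⟩⟩
  simp only [delta, deriv_newtonian hc.ne', ciInf_const]
  field_simp

end

end NBody

end

theorem mainTheorem4 (d : ℕ) (hd : 1 ≤ d) (m : Fin (d + 1) → ℝ) (hm : ∀ a, 0 < m a)
    (G : ℝ) (hG : 0 < G) :
    (∀ f : Fin (d + 1) → Fin (d + 1) → ℝ → ℝ, (∀ a b, a < b → NBody.IsAttractive (f a b)) →
      ∃ g : NBody.Config d × NBody.Config d → ℝ,
        NBody.IsOscillatorCoefficient G m f g ∧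
        ∀ (c : ℝ) (q v : NBody.Config d), (q, v) ∈ NBody.regularStates m →
          (∀ a b, dist (q a) (q b) ≤ c) →
          G * NBody.totalMass m * NBody.delta f c ≤ g (q, v)) ∧
    (∃ g : NBody.Config d × NBody.Config d → ℝ,
        NBody.IsOscillatorCoefficient G m (NBody.newtonian d) g ∧
        ∀ (c : ℝ) (q v : NBody.Config d), (q, v) ∈ NBody.regularStates m →
          (∀ a b, dist (q a) (q b) ≤ c) →
          G * NBody.totalMass m / c ^ 3 ≤ g (q, v)) := by
  refine ⟨fun f hf => ⟨NBody.oscillatorCoefficient G m f,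
    NBody.isOscillatorCoefficient_oscillatorCoefficient hd hm hG hf,
    fun c q v hqv hc => NBody.le_oscillatorCoefficient hd hm hG hf hqv hc⟩,
    NBody.oscillatorCoefficient G m (NBody.newtonian d),
    NBody.isOscillatorCoefficient_oscillatorCoefficient hd hm hG
      fun a b _ => NBody.isAttractive_newtonian a b, fun c q v hqv hc => ?_⟩
  have hlt : (0 : Fin (d + 1)) < Fin.last d := by simpa [Fin.lt_def] using Nat.pos_of_ne_zero (by omega)
  -- As d ≥ 1 there are two distinct masses, and their positive distance forces c > 0.
  have hc0 : 0 < c := (NBody.CollisionFree.dist_pos hqv.1 hlt).trans_le (hc _ _)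
  have h := NBody.le_oscillatorCoefficient hd hm hG
    (fun a b _ => NBody.isAttractive_newtonian a b) hqv hc
  rwa [NBody.delta_newtonian hd hc0, mul_one_div] at h
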